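/- **Setting.** For a continuous $f:\mathbb T\to\mathbb C$ (or a bounded measurable one) let $f_j$, $j\in\mathbb Z$, be its Fourier coefficients, and let $T_n(f)=(f_{i-j})_{i,j=0}^{n-1}$ be its $n\times n$ Toeplitz matrix, identified with the operator $h\mapsto P_n(fh)$ on the polynomials of degree at most $n-1$ (with the norm of $L_2(\mathbb T)$). For $\alpha\ge 2$ let $\mathsf{CSL}^\alpha$ be the set of all continuous $a:\mathbb T\to\mathbb C$ with $\sum_{j\in\mathbb Z}|a_j|(|j|+1)^\alpha<\infty$ such that $g(\varphi)=a(e^{i\varphi})$ satisfies $g(\varphi)=g(2\pi-\varphi)$ on $[0,2\pi]$, $g$ is injective on $[0,\pi]$ (so its image is a simple arc with distinct end points $g(0)\neq g(\pi)$), $g'(\varphi)\ne0$ for $\varphi\in(0,\pi)$, $g''(0)\neq0$ and $g''(\pi)\ne0$. Put $a_n(t)=\sum_{|j|\le n-1}a_jt^j$ and $g_n(\psi)=a_n(e^{i\psi})$ for $\psi\in\mathbb C$. For fixed $c,C>0$ put $$\Pi_n(a)=\{\varphi+i\delta:\ \varphi\in[c/n,\pi-c/n],\ \delta\in[-C/n,C/n]\},\qquad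 \mathcal R_n(a)=g_n(\Pi_n(a)).$$ For $s\in\Pi_n(a)$ and $\lambda=g_n(s)$ put $$\hat b_n(t,\lambda)=\frac{(a_n(t)-\lambda)e^{is}}{(t-e^{is})(t^{-1}-e^{is})},\qquad \tilde b_n(t,\lambda)=\hat b_n(1/t,\lambda)\qquad(t\in\mathbb T)$$ (removable singularities being removed), and, with $\chi_0=1$, $$\Theta_{n+2}(t,\lambda)=\big[T_{n+2}(\hat b_n(\cdot,\lambda))^{-1}\chi_0\big](t),\qquad \hat\Theta_{n+2}(t,\lambda)=\big[T_{n+2}(\tilde b_n(\cdot,\lambda))^{-1}\chi_0\big](t^{-1})\qquad(t\in\mathbb C\setminus\{0\}).$$ **Theorem.** Let $\alpha\ge2$, $a\in\mathsf{CSL}^\alpha$, and $c,C>0$. There are $N_0\in\mathbb N$ and $M$, depending only on $a$, $c$, $C$, such that for all $n>N_0$: 1. $g_n$ is injective on $\Pi_n(a)$; so each $\lambda\in\mathcal R_n(a)$ is $g_n(s)$ for exactly one $s\in\Pi_n(a)$, and $\hat b_n(\cdot,\lambda)$, $\tilde b_n(\cdot,\lambda)$ depend on $\lambda$ only. 2.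 For every $\lambda\in\mathcal R_n(a)$ the operators $T_{n+2}(\hat b_n(\cdot,\lambda))$ and $T_{n+2}(\tilde b_n(\cdot,\lambda))$ are invertible, and the $L_2$ operator norms of their inverses are at most $M$. 3. For every $\lambda=g_n(s)\in\mathcal R_n(a)$, $s\in\Pi_n(a)$: $\lambda$ is an eigenvalue of $T_n(a)$ if and only if $$e^{-i(n+1)s}\,\Theta_{n+2}(e^{is},\lambda)\,\hat\Theta_{n+2}(e^{-is},\lambda)-e^{i(n+1)s}\,\Theta_{n+2}(e^{-is},\lambda)\,\hat\Theta_{n+2}(e^{is},\lambda)=0.$$ -/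

import Mathlib

noncomputable section

namespace ToeplitzCSL

/-- The Fourier coefficient `f_j` of a function `f` on the unit circle, i.e.
`(2π)⁻¹ ∫ φ in 0..2π, f (exp (i φ)) * exp (-i j φ)`. -/
def coeff (f : Circle → ℂ) (j : ℤ) : ℂ :=
  haveI : Fact (0 < 2 * Real.pi) := ⟨Real.two_pi_pos⟩
  fourierCoeff (T := 2 * Real.pi) (fun x : AddCircle (2 * Real.pi) => f (AddCircle.toCircle x)) j

/-- The weighted Wiener algebra `W^α`: the (continuous) functions on the unit circle with
`∑ |a_j| (|j| + 1)^α < ∞`. -/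
def MemWiener (α : ℝ) (a : Circle → ℂ) : Prop :=
  Continuous a ∧ Summable fun j : ℤ => ‖coeff a j‖ * (|(j : ℝ)| + 1) ^ α

/-- `g(φ) = a(exp(i φ))`, for real `φ`. -/
def g (a : Circle → ℂ) (φ : ℝ) : ℂ := a (Circle.exp φ)

/-- The class `CSL^α` of complex-valued symmetric simple-loop functions. -/
structure MemCSL (α : ℝ) (a : Circle → ℂ) : Prop where
  memWiener : MemWiener α a
  symm : ∀ φ ∈ Set.Icc (0 : ℝ) (2 * Real.pi), g a φ = g a (2 * Real.pi - φ)
  simple_arc : Set.InjOn (g a) (Set.Icc 0 Real.pi)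
  endpoints_ne : g a 0 ≠ g a Real.pi
  deriv_ne : ∀ φ ∈ Set.Ioo (0 : ℝ) Real.pi, deriv (g a) φ ≠ 0
  deriv2_zero_ne : iteratedDeriv 2 (g a) 0 ≠ 0
  deriv2_pi_ne : iteratedDeriv 2 (g a) Real.pi ≠ 0

/-- The `n × n` Toeplitz matrix `T_n(f) = (f_{i-j})`, the matrix of `h ↦ P_n (f h)` in the basis
`1, t, …, t^(n-1)`. -/
def toeplitz (n : ℕ) (f : Circle → ℂ) : Matrix (Fin n) (Fin n) ℂ :=
  Matrix.of fun i j => coeff f ((i : ℤ) - (j : ℤ))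

/-- The Laurent polynomial `a_n(z) = ∑_{|j| ≤ n-1} a_j z^j`, for complex `z ≠ 0`. -/
def aN (a : Circle → ℂ) (n : ℕ) (z : ℂ) : ℂ :=
  ∑ j ∈ Finset.Icc (-((n : ℤ) - 1)) ((n : ℤ) - 1), coeff a j * z ^ j

/-- `g_n(ψ) = a_n(exp(i ψ))`, for complex `ψ`. -/
def gN (a : Circle → ℂ) (n : ℕ) (ψ : ℂ) : ℂ := aN a n (Complex.exp (Complex.I * ψ))

/-- The rectangle `Π_n = {φ + i δ : φ ∈ [c/n, π - c/n], δ ∈ [-C/n, C/n]}`. -/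
def PiN (c C : ℝ) (n : ℕ) : Set ℂ :=
  {ψ | ψ.re ∈ Set.Icc (c / n) (Real.pi - c / n) ∧ ψ.im ∈ Set.Icc (-(C / n)) (C / n)}

/-- The function `b̂_n(t, λ)` on the unit circle, for `λ = g_n(s)`:
`(a_n(t) - λ) e^{is} / ((t - e^{is}) (t⁻¹ - e^{is}))`.
For real `s` the quotient is `0 / 0` at the two points `t = e^{is}, e^{-is}` (removable
singularities of a Laurent polynomial); the value there does not matter, as only the Fourier
coefficients of this function are used. -/
def hatB (a : Circle → ℂ) (n : ℕ) (s : ℂ) (t : Circle) : ℂ :=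
  (aN a n (t : ℂ) - gN a n s) * Complex.exp (Complex.I * s) /
    (((t : ℂ) - Complex.exp (Complex.I * s)) * ((t : ℂ)⁻¹ - Complex.exp (Complex.I * s)))

/-- `b̃_n(t, λ) = b̂_n(1/t, λ)`, for `λ = g_n(s)`. -/
def tildeB (a : Circle → ℂ) (n : ℕ) (s : ℂ) (t : Circle) : ℂ := hatB a n s t⁻¹

/-- The value at `z` of the polynomial `T_{m+1}(f)⁻¹ χ_0`, where `χ_0 = 1`. -/
def invChiZero (m : ℕ) (f : Circle → ℂ) (z : ℂ) : ℂ :=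
  ∑ k : Fin (m + 1), ((toeplitz (m + 1) f)⁻¹.mulVec (Pi.single 0 1)) k * z ^ (k : ℕ)

/-- `Θ_{n+2}(z, λ) = [T_{n+2}(b̂_n(·, λ))⁻¹ χ_0](z)`, for `λ = g_n(s)`. -/
def Theta (a : Circle → ℂ) (n : ℕ) (s z : ℂ) : ℂ := invChiZero (n + 1) (hatB a n s) z

/-- `Θ̂_{n+2}(z, λ) = [T_{n+2}(b̃_n(·, λ))⁻¹ χ_0](z⁻¹)`, for `λ = g_n(s)`. -/
def hatTheta (a : Circle → ℂ) (n : ℕ) (s z : ℂ) : ℂ := invChiZero (n + 1) (tildeB a n s) z⁻¹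

end ToeplitzCSL

end

/-! Put `w = e^{is}`. Since `a` is even, `a_n` is a polynomial in `t + t⁻¹`, so `a_n(t) - λ = (w +
w⁻¹ - t - t⁻¹) b̂_n(t)`, where `b̂_n` is minus a divided difference and is itself even
(`MemCSL.aN_sub_aN`). In particular `b̃_n = b̂_n`.

Uniform invertibility comes from compactness. Along a sequence with `n → ∞`, the points `s`
accumulate at some `φ ∈ [0, π]`. Powers of `w` up to `n` stay below `e^C`, and `∑ |a_j| j² < ∞`, so
`b̂_n` converges uniformly (`norm_divDiff_le`, `tendsto_symbolN`). The limit at angle `σ` is the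
quotient of `g(σ) - g(φ)` by `2 cos φ - 2 cos σ`, with values governed by `g'`, and by `g''` at `0`
and `π`, where this degenerates. The simple-loop conditions say precisely that it has no zeros
(`MemCSL.symbol_ne_zero`). The same limit yields injectivity of `g_n`.

It remains to see that an even symbol without zeros has stable finite sections
(`exists_norm_le_toeplitzMat`). Up to a factor close to `1` it is a polynomial in `t + t⁻¹`, whose
linear factors `t + t⁻¹ - ρ` have an explicit Wiener-Hopf factorization. The Toeplitz operator on
the Hardy space thus has a left inverse that is a norm limit of banded operators
(`exists_isLocal_leftInverse`). Such an inverse bounds a vector by its image under the finite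
section except near the right end; reversing the coordinates, a symmetry of the matrix, covers the
right end too. Stability persists for nearby symbols with the same constants.

For the eigenvalue criterion, let `R` be a polynomial of degree below `n`. Applying `T_{n+2}(b̂_n)`
to `(z² - (w + w⁻¹) z + 1) R` gives `λ R - T_n(a) R` in the middle rows
(`MemCSL.toeplitzMat_mulVec_quadratic`). So eigenvectors correspond to nonzero combinations of the
first and last columns of `T_{n+2}(b̂_n)⁻¹` that vanish at `w` and `w⁻¹`. The last column is the
reversed first one, and the stated equation is the vanishing of a `2 × 2` determinant
(`MemCSL.hasEigenvalue_iff`). -/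

noncomputable section

namespace ToeplitzCSL

open MeasureTheory AddCircle Complex
open scoped ENNReal

/-! ### Multiplication operators on `L²` of the circle -/

section Multiplication

variable {T : ℝ} [hT : Fact (0 < T)]

/-- The Hilbert space of square integrable functions on the circle. -/
abbrev L2 (T : ℝ) [Fact (0 < T)] : Type := Lp ℂ 2 (haarAddCircle (T := T))

/-- Multiplication by a continuous function, as an operator on `L2`. -/
def mulOp : C(AddCircle T, ℂ) →L[ℂ] L2 T →L[ℂ] L2 T :=
  ((ContinuousLinearMap.mul ℂ ℂ).holderL (haarAddCircle (T := T)) ∞ 2 2).comp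
    (ContinuousMap.toLp (E := ℂ) ∞ (haarAddCircle (T := T)) ℂ)

theorem coeFn_mulOp (b : C(AddCircle T, ℂ)) (x : L2 T) :
    mulOp b x =ᵐ[haarAddCircle] fun t => b t * x t := by
  have h1 := (ContinuousLinearMap.mul ℂ ℂ).coeFn_holder (r := 2)
    (ContinuousMap.toLp (E := ℂ) ∞ (haarAddCircle (T := T)) ℂ b) x
  have h2 := ContinuousMap.coeFn_toLp (p := ∞) (𝕜 := ℂ) (haarAddCircle (T := T)) b
  refine Filter.EventuallyEq.trans h1 ?_
  filter_upwards [h2] with t ht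
  rw [ContinuousLinearMap.mul_apply', ht]

theorem norm_mulOp_le (b : C(AddCircle T, ℂ)) : ‖mulOp b‖ ≤ ‖b‖ := by
  refine ContinuousLinearMap.opNorm_le_bound _ (norm_nonneg _) fun x => ?_
  refine Lp.norm_le_mul_norm_of_ae_le_mul ?_
  filter_upwards [coeFn_mulOp b x] with t ht
  rw [ht, norm_mul]
  exact mul_le_mul_of_nonneg_right (b.norm_coe_le_norm t) (norm_nonneg _)

theorem mulOp_one : mulOp (1 : C(AddCircle T, ℂ)) = 1 := by
  ext1 x
  refine Lp.ext ?_
  filter_upwards [coeFn_mulOp 1 x] with t ht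
  simpa using ht

theorem mulOp_mul (b c : C(AddCircle T, ℂ)) : mulOp (b * c) = mulOp b * mulOp c := by
  ext1 x
  refine Lp.ext ?_
  filter_upwards [coeFn_mulOp (b * c) x, coeFn_mulOp b (mulOp c x), coeFn_mulOp c x]
    with t h1 h2 h3
  simp [h1, h2, h3, mul_assoc]

theorem mulOp_fourier_fourierLp (k j : ℤ) :
    mulOp (fourier k) (fourierLp (T := T) 2 j) = fourierLp 2 (j + k) := by
  refine Lp.ext ?_
  filter_upwards [coeFn_mulOp (fourier k) (fourierLp (T := T) 2 j), coeFn_fourierLp (T := T) 2 j,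
    coeFn_fourierLp (T := T) 2 (j + k)] with t h1 h2 h3
  rw [h1, h2, h3, fourier_add, mul_comm]

theorem inner_fourierLp_mulOp (b : C(AddCircle T, ℂ)) (i j : ℤ) :
    inner ℂ (fourierLp (T := T) 2 i) (mulOp b (fourierLp 2 j)) = fourierCoeff b (i - j) := by
  rw [L2.inner_def, fourierCoeff]
  refine integral_congr_ae ?_
  filter_upwards [coeFn_mulOp b (fourierLp (T := T) 2 j), coeFn_fourierLp (T := T) 2 j,
    coeFn_fourierLp (T := T) 2 i] with t h1 h2 h3
  rw [h1, h2, h3, neg_sub, sub_eq_add_neg, fourier_add, fourier_neg]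
  simp only [RCLike.inner_apply, smul_eq_mul]
  ring

theorem inner_mulOp_fourier_left (k : ℤ) (x y : L2 T) :
    inner ℂ (mulOp (fourier k) x) y = inner ℂ x (mulOp (fourier (-k)) y) := by
  rw [L2.inner_def, L2.inner_def]
  refine integral_congr_ae ?_
  filter_upwards [coeFn_mulOp (fourier k) x, coeFn_mulOp (fourier (-k)) y] with t h1 h2
  rw [h1, h2, fourier_neg]
  simp only [RCLike.inner_apply, map_mul]
  ring

end Multiplication

/-! ### Geometric series in closed subalgebras -/

section ClosedSubalgebra

/-- This puts `(1 - x)⁻¹` into the subalgebra. It serves both for coanalytic functions and for local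
operators. -/
theorem tsum_pow_mem_of_isClosed {𝓐 : Type*} [NormedRing 𝓐] [NormedAlgebra ℂ 𝓐] [CompleteSpace 𝓐]
    (S : Subalgebra ℂ 𝓐) (hS : IsClosed (S : Set 𝓐)) {x : 𝓐} (hx : x ∈ S) (h : ‖x‖ < 1) :
    ∑' n : ℕ, x ^ n ∈ S := by
  have hs := (summable_geometric_of_norm_lt_one h).hasSum
  exact hS.mem_of_tendsto hs (.of_forall fun s => S.sum_mem fun i _ => S.pow_mem hx i)

end ClosedSubalgebra

/-! ### Local operators and projections onto tails -/

section Local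

variable {E : Type*} [NormedAddCommGroup E] [InnerProductSpace ℂ E] (e : ℤ → E)

/-- The vectors whose coordinates before `m` vanish. -/
def tail (m : ℤ) : Submodule ℂ E := (Submodule.span ℂ (e '' Set.Iio m))ᗮ

variable {e}

theorem mem_tail {m : ℤ} {x : E} : x ∈ tail e m ↔ ∀ j < m, inner ℂ (e j) x = 0 := by
  rw [tail, Submodule.mem_orthogonal]
  constructor
  · intro h j hj
    exact h _ (Submodule.subset_span ⟨j, hj, rfl⟩)
  · intro h u hu
    induction hu using Submodule.span_induction with
    | mem u hu => obtain ⟨j, hj, rfl⟩ := hu; exact h j hj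
    | zero => simp
    | add u v _ _ h1 h2 => rw [inner_add_left, h1, h2, add_zero]
    | smul c u _ h1 => rw [inner_smul_left, h1, mul_zero]

theorem tail_anti {m m' : ℤ} (h : m ≤ m') : tail e m' ≤ tail e m := fun _ hx =>
  mem_tail.2 fun j hj => mem_tail.1 hx j (hj.trans_le h)

theorem isClosed_tail (m : ℤ) : IsClosed (tail e m : Set E) :=
  Submodule.isClosed_orthogonal _

theorem Orthonormal.mem_tail (he : Orthonormal ℂ e) {m j : ℤ} (h : m ≤ j) : e j ∈ tail e m :=
  ToeplitzCSL.mem_tail.2 fun _ hi => he.inner_eq_zero (hi.trans_le h).ne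

variable (e) in
/-- Operators that are limits of banded ones, in one direction. -/
def IsLocal (A : E →L[ℂ] E) : Prop :=
  ∀ ε > 0, ∃ d : ℕ, ∀ m : ℤ, ∀ x ∈ tail e m, ∃ y ∈ tail e (m - d), ‖A x - y‖ ≤ ε * ‖x‖

theorem IsLocal.of_maps {A : E →L[ℂ] E} (d : ℕ)
    (h : ∀ m : ℤ, ∀ x ∈ tail e m, A x ∈ tail e (m - d)) : IsLocal e A := fun ε hε =>
  ⟨d, fun m x hx => ⟨A x, h m x hx, by rw [sub_self, norm_zero]; positivity⟩⟩

theorem IsLocal.add {A B : E →L[ℂ] E} (hA : IsLocal e A) (hB : IsLocal e B) :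
    IsLocal e (A + B) := by
  intro ε hε
  obtain ⟨d, hd⟩ := hA (ε / 2) (by positivity)
  obtain ⟨d', hd'⟩ := hB (ε / 2) (by positivity)
  refine ⟨max d d', fun m x hx => ?_⟩
  obtain ⟨y, hy, hy'⟩ := hd m x hx
  obtain ⟨z, hz, hz'⟩ := hd' m x hx
  refine ⟨y + z, add_mem (tail_anti (by push_cast; omega) hy) (tail_anti (by push_cast; omega) hz),
    ?_⟩
  calc ‖(A + B) x - (y + z)‖ = ‖(A x - y) + (B x - z)‖ := by
        rw [add_apply]; congr 1; abel
    _ ≤ ε / 2 * ‖x‖ + ε / 2 * ‖x‖ := norm_add_le_of_le hy' hz'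
    _ = ε * ‖x‖ := by ring

theorem IsLocal.mul {A B : E →L[ℂ] E} (hA : IsLocal e A) (hB : IsLocal e B) :
    IsLocal e (A * B) := by
  intro ε hε
  obtain ⟨d, hd⟩ := hA (ε / (2 * (‖B‖ + 1))) (by positivity)
  -- The bound by `1` gives `‖y‖ ≤ (‖B‖ + 1) ‖x‖` for the approximant; the other bound absorbs the
  -- later application of `A`.
  obtain ⟨d', hd'⟩ := hB (min 1 (ε / (2 * (‖A‖ + 1)))) (by positivity)
  refine ⟨d + d', fun m x hx => ?_⟩
  obtain ⟨y, hy, hy'⟩ := hd' m x hx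
  obtain ⟨z, hz, hz'⟩ := hd _ y hy
  refine ⟨z, tail_anti (by push_cast; omega) hz, ?_⟩
  have h1 : ‖y‖ ≤ (‖B‖ + 1) * ‖x‖ := by
    have h2 : ‖B x - y‖ ≤ 1 * ‖x‖ :=
      hy'.trans (mul_le_mul_of_nonneg_right (min_le_left _ _) (norm_nonneg _))
    have h3 : ‖y‖ ≤ ‖B x‖ + ‖B x - y‖ := norm_le_norm_add_norm_sub _ _
    have h4 := B.le_opNorm x
    linarith
  have h2 : ‖A (B x - y)‖ ≤ ε / 2 * ‖x‖ := by
    calc ‖A (B x - y)‖ ≤ ‖A‖ * ‖B x - y‖ := A.le_opNorm _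
      _ ≤ (‖A‖ + 1) * (ε / (2 * (‖A‖ + 1)) * ‖x‖) := by
          gcongr
          · linarith
          · exact hy'.trans (mul_le_mul_of_nonneg_right (min_le_right _ _) (norm_nonneg _))
      _ = ε / 2 * ‖x‖ := by field_simp
  have h3 : ‖A y - z‖ ≤ ε / 2 * ‖x‖ := by
    calc ‖A y - z‖ ≤ ε / (2 * (‖B‖ + 1)) * ((‖B‖ + 1) * ‖x‖) := hz'.trans (by gcongr)
      _ = ε / 2 * ‖x‖ := by field_simp
  calc ‖(A * B) x - z‖ = ‖A (B x - y) + (A y - z)‖ := by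
        rw [map_sub, mul_apply_eq_comp]; congr 1; abel
    _ ≤ ε / 2 * ‖x‖ + ε / 2 * ‖x‖ := norm_add_le_of_le h2 h3
    _ = ε * ‖x‖ := by ring

theorem isLocal_algebraMap (c : ℂ) : IsLocal e (algebraMap ℂ (E →L[ℂ] E) c) :=
  .of_maps 0 fun m x hx => by
    simpa [Algebra.algebraMap_eq_smul_one] using (tail e m).smul_mem c hx

variable (e) in
/-- The algebra of local operators. -/
def localSubalgebra : Subalgebra ℂ (E →L[ℂ] E) where
  carrier := {A | IsLocal e A}
  mul_mem' hA hB := hA.mul hB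
  add_mem' hA hB := hA.add hB
  algebraMap_mem' c := isLocal_algebraMap c

/-- The tolerance `ε` in `IsLocal` absorbs the approximation error. Closedness is what admits all
continuous symbols and Neumann series. -/
theorem isClosed_localSubalgebra : IsClosed (localSubalgebra e : Set (E →L[ℂ] E)) := by
  refine isClosed_of_closure_subset fun A hA ε hε => ?_
  obtain ⟨B, hB, hAB⟩ := Metric.mem_closure_iff.1 hA (ε / 2) (by positivity)
  obtain ⟨d, hd⟩ := hB (ε / 2) (by positivity)
  refine ⟨d, fun m x hx => ?_⟩
  obtain ⟨y, hy, hy'⟩ := hd m x hx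
  refine ⟨y, hy, ?_⟩
  have h1 : ‖(A - B) x‖ ≤ ε / 2 * ‖x‖ := by
    refine ((A - B).le_opNorm x).trans ?_
    rw [dist_eq_norm] at hAB
    gcongr
  calc ‖A x - y‖ = ‖(A - B) x + (B x - y)‖ := by rw [sub_apply]; congr 1; abel
    _ ≤ ε / 2 * ‖x‖ + ε / 2 * ‖x‖ := norm_add_le_of_le h1 hy'
    _ = ε * ‖x‖ := by ring

/-- The operators that map the subspace `V` to itself. -/
def invariantSubalgebra (V : Submodule ℂ E) : Subalgebra ℂ (E →L[ℂ] E) where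
  carrier := {A | ∀ x ∈ V, A x ∈ V}
  mul_mem' hA hB x hx := hA _ (hB x hx)
  add_mem' hA hB x hx := V.add_mem (hA x hx) (hB x hx)
  algebraMap_mem' c x hx := by
    simpa [Algebra.algebraMap_eq_smul_one] using V.smul_mem c hx

theorem isClosed_invariantSubalgebra {V : Submodule ℂ E} (hV : IsClosed (V : Set E)) :
    IsClosed (invariantSubalgebra V : Set (E →L[ℂ] E)) := by
  have : (invariantSubalgebra V : Set (E →L[ℂ] E)) = ⋂ x ∈ V, (fun A => A x) ⁻¹' (V : Set E) := by
    ext A; simp only [Set.mem_iInter]; rfl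
  rw [this]
  refine isClosed_biInter fun x _ => hV.preimage ?_
  exact (ContinuousLinearMap.apply ℂ E x).continuous

variable [CompleteSpace E]

instance (m : ℤ) : (tail e m).HasOrthogonalProjection :=
  haveI : CompleteSpace (tail e m) := (isClosed_tail m).completeSpace_coe
  inferInstance

variable (e) in
/-- The orthogonal projection onto the vectors whose coordinates before `m` vanish. -/
def tailProj (m : ℤ) : E →L[ℂ] E := (tail e m).starProjection

theorem tailProj_mem (m : ℤ) (x : E) : tailProj e m x ∈ tail e m :=
  Submodule.starProjection_apply_mem _ _

theorem tailProj_of_mem {m : ℤ} {x : E} (hx : x ∈ tail e m) : tailProj e m x = x :=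
  Submodule.starProjection_eq_self_iff.2 hx

theorem tailProj_of_mem_orthogonal {m : ℤ} {x : E} (hx : x ∈ (tail e m)ᗮ) : tailProj e m x = 0 :=
  (Submodule.starProjection_apply_eq_zero_iff _).2 hx

theorem sub_tailProj_mem (m : ℤ) (x : E) : x - tailProj e m x ∈ (tail e m)ᗮ :=
  Submodule.sub_starProjection_mem_orthogonal _

theorem norm_tailProj_le (m : ℤ) : ‖tailProj e m‖ ≤ 1 :=
  Submodule.starProjection_norm_le _

theorem inner_tailProj (he : Orthonormal ℂ e) {m j : ℤ} (h : m ≤ j) (x : E) :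
    inner ℂ (e j) (tailProj e m x) = inner ℂ (e j) x := by
  have := (Submodule.mem_orthogonal _ _).1 (sub_tailProj_mem m x) _ (Orthonormal.mem_tail he h)
  rw [inner_sub_right, sub_eq_zero] at this
  exact this.symm

theorem IsLocal.tailProj (he : Orthonormal ℂ e) (k : ℤ) : IsLocal e (tailProj e k) :=
  .of_maps 0 fun m x hx => by
    refine mem_tail.2 fun j hj => ?_
    by_cases h : j < k
    · exact mem_tail.1 (tailProj_mem k x) j h
    · rw [inner_tailProj he (not_lt.1 h)]
      exact mem_tail.1 hx j (by simpa using hj)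

end Local

/-! ### Locality and analyticity of multiplication operators -/

section Circle

variable {T : ℝ} [hT : Fact (0 < T)]

theorem mulOp_fourier_mem_tail (k m : ℤ) {x : L2 T} (hx : x ∈ tail (fourierLp (T := T) 2) m) :
    mulOp (fourier k) x ∈ tail (fourierLp (T := T) 2) (m + k) := by
  refine mem_tail.2 fun j hj => ?_
  have h := inner_mulOp_fourier_left (-k) (fourierLp (T := T) 2 j) x
  rw [neg_neg, mulOp_fourier_fourierLp] at h
  rw [← h]
  exact mem_tail.1 hx _ (by omega)

/-- Multiplication by `fourier k` shifts tails by `k`. Trigonometric polynomials are dense, and the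
local operators form a closed subspace. -/
theorem isLocal_mulOp (b : C(AddCircle T, ℂ)) : IsLocal (fourierLp (T := T) 2) (mulOp b) := by
  let S : Submodule ℂ C(AddCircle T, ℂ) :=
    (Subalgebra.toSubmodule (localSubalgebra (fourierLp (T := T) 2))).comap
      (mulOp (T := T)).toLinearMap
  have hS : IsClosed (S : Set C(AddCircle T, ℂ)) :=
    isClosed_localSubalgebra.preimage (mulOp (T := T)).continuous
  have h1 : Submodule.span ℂ (Set.range (fourier (T := T))) ≤ S := by
    rw [Submodule.span_le]
    rintro _ ⟨k, rfl⟩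
    exact IsLocal.of_maps k.natAbs fun m x hx =>
      tail_anti (by omega) (mulOp_fourier_mem_tail k m hx)
  have h2 := Submodule.topologicalClosure_minimal _ h1 hS
  rw [span_fourier_closure_eq_top] at h2
  exact h2 (Submodule.mem_top (x := b))

variable (T) in
/-- Multiplication by continuous functions as an algebra homomorphism. -/
def mulOpHom : C(AddCircle T, ℂ) →ₐ[ℂ] (L2 T →L[ℂ] L2 T) :=
  AlgHom.ofLinearMap (mulOp (T := T)).toLinearMap mulOp_one mulOp_mul

variable (T) in
/-- The continuous functions whose multiplication operator preserves the Hardy space. -/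
def analyticSubalgebra : Subalgebra ℂ C(AddCircle T, ℂ) :=
  (invariantSubalgebra (tail (fourierLp (T := T) 2) 0)).comap (mulOpHom T)

variable (T) in
/-- The continuous functions whose multiplication operator preserves the orthogonal complement of
the Hardy space. -/
def coanalyticSubalgebra : Subalgebra ℂ C(AddCircle T, ℂ) :=
  (invariantSubalgebra (tail (fourierLp (T := T) 2) 0)ᗮ).comap (mulOpHom T)

theorem isClosed_coanalyticSubalgebra :
    IsClosed (coanalyticSubalgebra T : Set C(AddCircle T, ℂ)) :=
  (isClosed_invariantSubalgebra (Submodule.isClosed_orthogonal _)).preimage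
    (mulOp (T := T)).continuous

theorem fourier_one_mem_analyticSubalgebra : fourier 1 ∈ analyticSubalgebra T := fun _ hx =>
  tail_anti (by norm_num) (mulOp_fourier_mem_tail 1 0 hx)

theorem fourier_neg_one_mem_coanalyticSubalgebra : fourier (-1) ∈ coanalyticSubalgebra T := by
  intro x hx
  refine (Submodule.mem_orthogonal _ _).2 fun y hy => ?_
  have h := inner_mulOp_fourier_left 1 y x
  refine h.symm.trans ?_
  exact (Submodule.mem_orthogonal _ _).1 hx _ (tail_anti (by norm_num) (mulOp_fourier_mem_tail 1 0 hy))

end Circle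

/-! ### Wiener-Hopf factorization of even symbols -/

section Factorization

variable {T : ℝ}

/-- The function `t + t⁻¹`. -/
def tau (T : ℝ) : C(AddCircle T, ℂ) := fourier 1 + fourier (-1)

theorem fourier_one_mul_fourier_neg_one :
    (fourier 1 * fourier (-1) : C(AddCircle T, ℂ)) = 1 := by
  ext x
  rw [ContinuousMap.mul_apply, ← fourier_add]
  simp

theorem tau_apply (x : AddCircle T) :
    tau T x = (toCircle x : ℂ) + (toCircle x : ℂ)⁻¹ := by
  rw [tau, ContinuousMap.add_apply, fourier_neg, fourier_one, ← Circle.coe_inv_eq_conj,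
    Circle.coe_inv]

variable (T) in
/-- The closed algebra generated by `t + t⁻¹`. -/
def evenSubalgebra : Subalgebra ℂ C(AddCircle T, ℂ) :=
  (Algebra.adjoin ℂ {tau T}).topologicalClosure

theorem tau_mem_evenSubalgebra : tau T ∈ evenSubalgebra T :=
  Subalgebra.le_topologicalClosure _ (Algebra.self_mem_adjoin_singleton ℂ _)

theorem isClosed_evenSubalgebra : IsClosed (evenSubalgebra T : Set C(AddCircle T, ℂ)) :=
  Subalgebra.isClosed_topologicalClosure _

theorem apply_neg_of_mem_evenSubalgebra {b : C(AddCircle T, ℂ)} (hb : b ∈ evenSubalgebra T)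
    (x : AddCircle T) : b (-x) = b x := by
  let S : Subalgebra ℂ C(AddCircle T, ℂ) :=
    { carrier := {b | b (-x) = b x}
      mul_mem' := fun {b c} hb hc => by
        change b (-x) * c (-x) = b x * c x
        rw [show b (-x) = b x from hb, show c (-x) = c x from hc]
      add_mem' := fun {b c} hb hc => by
        change b (-x) + c (-x) = b x + c x
        rw [show b (-x) = b x from hb, show c (-x) = c x from hc]
      algebraMap_mem' := fun c => rfl }
  have hS : IsClosed (S : Set C(AddCircle T, ℂ)) :=
    isClosed_eq (continuous_eval_const _) (continuous_eval_const _)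
  refine Subalgebra.topologicalClosure_minimal (t := S) ?_ hS hb
  rw [Algebra.adjoin_le_iff, Set.singleton_subset_iff]
  change tau T (-x) = tau T x
  rw [tau_apply, tau_apply, toCircle_neg, Circle.coe_inv, inv_inv, add_comm]

variable [hT : Fact (0 < T)]

/-- The product of an invertible analytic function and of an invertible function with coanalytic
inverse. -/
def HasFactorization (b : C(AddCircle T, ℂ)) : Prop :=
  ∃ p p' q q' : C(AddCircle T, ℂ), p * p' = 1 ∧ q * q' = 1 ∧ p ∈ analyticSubalgebra T ∧
    q' ∈ coanalyticSubalgebra T ∧ b = q * p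

theorem HasFactorization.mul {b c : C(AddCircle T, ℂ)} (hb : HasFactorization b)
    (hc : HasFactorization c) : HasFactorization (b * c) := by
  obtain ⟨p, p', q, q', h1, h2, h3, h4, rfl⟩ := hb
  obtain ⟨r, r', s, s', k1, k2, k3, k4, rfl⟩ := hc
  refine ⟨p * r, p' * r', q * s, q' * s', ?_, ?_, mul_mem h3 k3, mul_mem h4 k4, by ring⟩
  · rw [mul_mul_mul_comm, h1, k1, one_mul]
  · rw [mul_mul_mul_comm, h2, k2, one_mul]

theorem hasFactorization_algebraMap {c : ℂ} (hc : c ≠ 0) :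
    HasFactorization (algebraMap ℂ C(AddCircle T, ℂ) c) :=
  ⟨_, algebraMap ℂ _ c⁻¹, 1, 1, by rw [← map_mul, mul_inv_cancel₀ hc, map_one], one_mul 1,
    Subalgebra.algebraMap_mem _ c, one_mem _, (one_mul _).symm⟩

/-- The identity is `t + t⁻¹ - w - w⁻¹ = -w⁻¹ (1 - w t⁻¹)(1 - w t)`. Both factors are inverted by
geometric series. -/
theorem hasFactorization_of_norm_lt_one {w : ℂ} (h0 : w ≠ 0) (h1 : ‖w‖ < 1) :
    HasFactorization (tau T - algebraMap ℂ _ (w + w⁻¹)) := by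
  have hn : ∀ k : ℤ, ‖w • fourier (T := T) k‖ < 1 := fun k => by
    rwa [norm_smul, fourier_norm, mul_one]
  have hp : HasFactorization ((1 - w • fourier (-1)) * (1 - w • fourier 1) :
      C(AddCircle T, ℂ)) :=
    ⟨1 - w • fourier 1, ∑' n : ℕ, (w • fourier 1) ^ n, 1 - w • fourier (-1),
      ∑' n : ℕ, (w • fourier (-1)) ^ n, mul_neg_geom_series _ (hn 1), mul_neg_geom_series _ (hn _),
      sub_mem (one_mem _) (Subalgebra.smul_mem _ fourier_one_mem_analyticSubalgebra w),
      tsum_pow_mem_of_isClosed _ isClosed_coanalyticSubalgebra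
        (Subalgebra.smul_mem _ fourier_neg_one_mem_coanalyticSubalgebra w) (hn _), rfl⟩
  have := (hasFactorization_algebraMap (T := T) (neg_ne_zero.2 (inv_ne_zero h0))).mul hp
  convert this using 1
  have h := fourier_one_mul_fourier_neg_one (T := T)
  have h2 : algebraMap ℂ C(AddCircle T, ℂ) w * algebraMap ℂ _ w⁻¹ = 1 := by
    rw [← map_mul, mul_inv_cancel₀ h0, map_one]
  simp only [Algebra.smul_def, tau, map_add, map_neg]
  linear_combination (-fourier 1 - fourier (-1) +
    algebraMap ℂ C(AddCircle T, ℂ) w * (fourier 1 * fourier (-1))) * h2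
    + algebraMap ℂ C(AddCircle T, ℂ) w * h

/-- Solve `ρ = w + w⁻¹`. The two solutions are reciprocal, so one may take `‖w‖ < 1` unless `‖w‖ =
1`, and then `w` would be a zero on the circle. -/
theorem hasFactorization_tau_sub {ρ : ℂ} (h : IsUnit (tau T - algebraMap ℂ _ ρ)) :
    HasFactorization (tau T - algebraMap ℂ _ ρ) := by
  obtain ⟨δ, hδ⟩ := IsAlgClosed.exists_pow_nat_eq (ρ ^ 2 - 4) (n := 2) (by norm_num)
  obtain ⟨w, h0, rfl⟩ : ∃ w : ℂ, w ≠ 0 ∧ ρ = w + w⁻¹ := by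
    have hw : (ρ + δ) / 2 * ((ρ - δ) / 2) = 1 := by linear_combination -hδ / 4
    refine ⟨(ρ + δ) / 2, left_ne_zero_of_mul_eq_one hw, ?_⟩
    rw [inv_eq_of_mul_eq_one_right hw]
    ring
  rcases lt_trichotomy ‖w‖ 1 with h1 | h1 | h1
  · exact hasFactorization_of_norm_lt_one h0 h1
  · obtain ⟨x, hx⟩ := (AddCircle.homeomorphCircle hT.out.ne').surjective
      ⟨w, mem_sphere_zero_iff_norm.2 h1⟩
    rw [AddCircle.homeomorphCircle_apply] at hx
    refine absurd ?_ ((ContinuousMap.isUnit_iff_forall_ne_zero _).1 h x)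
    rw [ContinuousMap.sub_apply, tau_apply, hx]
    simp
  · have := hasFactorization_of_norm_lt_one (T := T) (inv_ne_zero h0)
      (by rw [norm_inv]; exact inv_lt_one_of_one_lt₀ h1)
    rwa [inv_inv, add_comm] at this

theorem hasFactorization_of_mem_adjoin {b : C(AddCircle T, ℂ)}
    (hb : b ∈ Algebra.adjoin ℂ {tau T}) (h : IsUnit b) : HasFactorization b := by
  rw [Algebra.adjoin_singleton_eq_range_aeval] at hb
  obtain ⟨P, rfl⟩ := hb
  change IsUnit (Polynomial.aeval (tau T) P) at h
  change HasFactorization (Polynomial.aeval (tau T) P)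
  have hP : P ≠ 0 := by
    rintro rfl
    simp at h
  have key : ∀ s : Multiset ℂ,
      IsUnit (s.map fun ρ => tau T - algebraMap ℂ C(AddCircle T, ℂ) ρ).prod →
      HasFactorization (s.map fun ρ => tau T - algebraMap ℂ C(AddCircle T, ℂ) ρ).prod := by
    intro s
    induction s using Multiset.induction with
    | empty =>
      intro _
      have := hasFactorization_algebraMap (T := T) one_ne_zero
      rwa [map_one] at this
    | cons ρ s ih =>
      rw [Multiset.map_cons, Multiset.prod_cons]
      intro hu
      rw [IsUnit.mul_iff] at hu
      exact (hasFactorization_tau_sub hu.1).mul (ih hu.2)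
  have heq : Polynomial.aeval (tau T) P = algebraMap ℂ _ P.leadingCoeff *
      (P.roots.map fun ρ => tau T - algebraMap ℂ C(AddCircle T, ℂ) ρ).prod := by
    conv_lhs => rw [(IsAlgClosed.splits P).eq_prod_roots]
    rw [map_mul, Polynomial.aeval_C, map_multiset_prod, Multiset.map_map]
    simp
  rw [heq] at h ⊢
  rw [IsUnit.mul_iff] at h
  exact (hasFactorization_algebraMap (Polynomial.leadingCoeff_ne_zero.2 hP)).mul (key _ h.2)

theorem fourierCoeff_neg_of_even {b : AddCircle T → ℂ} (hb : ∀ x, b (-x) = b x) (j : ℤ) :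
    fourierCoeff b (-j) = fourierCoeff b j := by
  rw [fourierCoeff, fourierCoeff, ← integral_neg_eq_self]
  refine integral_congr_ae (.of_forall fun x => ?_)
  simp only [hb, fourier_apply, neg_neg, neg_smul, smul_neg]

/-- Take a polynomial `c` in `t + t⁻¹` so close to `b` that it is a unit and `ε = 1 - b c⁻¹` is
small. -/
theorem exists_eq_mul_one_sub {b : C(AddCircle T, ℂ)} (hb : b ∈ evenSubalgebra T)
    (h : IsUnit b) :
    ∃ c ε : C(AddCircle T, ℂ), HasFactorization c ∧ ‖ε‖ < 1 ∧ b = c * (1 - ε) := by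
  have h1 : Filter.Tendsto (fun c : C(AddCircle T, ℂ) => 1 - b * Ring.inverse c) (nhds b)
      (nhds 0) := by
    have := (NormedRing.inverse_continuousAt h.unit).tendsto
    have h2 := tendsto_const_nhds (x := (1 : C(AddCircle T, ℂ))).sub (this.const_mul b)
    simp only [IsUnit.unit_spec] at h2
    rwa [Ring.mul_inverse_cancel _ h, sub_self] at h2
  have h2 := (h1.norm.eventually_lt_const (u := 1) (by simp)).and
    (Units.nhds h.unit)
  obtain ⟨c, hc, hc1, hc2⟩ := (mem_closure_iff_frequently.1 hb).and_eventually h2 |>.exists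
  refine ⟨c, 1 - b * Ring.inverse c, hasFactorization_of_mem_adjoin hc hc2, hc1, ?_⟩
  rw [sub_sub_cancel, mul_left_comm, Ring.mul_inverse_cancel _ hc2, mul_one]

/-- A local left inverse of the Toeplitz operator of an even symbol without zeros. -/
theorem exists_isLocal_leftInverse {b : C(AddCircle T, ℂ)} (hb : b ∈ evenSubalgebra T)
    (h : IsUnit b) :
    ∃ G : L2 T →L[ℂ] L2 T, IsLocal (fourierLp (T := T) 2) G ∧
      ∀ x ∈ tail (fourierLp (T := T) 2) 0, G (tailProj (fourierLp 2) 0 (mulOp b x)) = x := by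
  obtain ⟨c, ε, ⟨p, p', q, q', h1, h2, h3, h4, rfl⟩, h5, rfl⟩ := exists_eq_mul_one_sub hb h
  set Q := tailProj (fourierLp (T := T) 2) 0
  set A := Q * mulOp ε * Q with hA
  have hQ : IsLocal (fourierLp (T := T) 2) Q := .tailProj orthonormal_fourier 0
  have hA1 : ‖A‖ < 1 := by
    have hQ1 : ‖Q‖ ≤ 1 := norm_tailProj_le 0
    calc ‖A‖ ≤ ‖Q‖ * ‖mulOp ε‖ * ‖Q‖ :=
          (norm_mul_le _ _).trans (mul_le_mul_of_nonneg_right (norm_mul_le _ _) (norm_nonneg _))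
      _ ≤ 1 * ‖ε‖ * 1 := by gcongr; exact norm_mulOp_le ε
      _ < 1 := by simpa using h5
  have hAl : A ∈ localSubalgebra (fourierLp (T := T) 2) := (hQ.mul (isLocal_mulOp ε)).mul hQ
  have hinv : (∑' n : ℕ, A ^ n) * (1 - A) = 1 := geom_series_mul_neg A hA1
  -- Undo the three factors of `q (1 - ε) p` in turn: `q'` removes `q`, the Neumann series inverts
  -- the compression of `1 - ε`, and `p'` removes `p`.
  refine ⟨mulOp p' * (∑' n : ℕ, A ^ n) * (Q * mulOp q'),
    ((isLocal_mulOp p').mul (tsum_pow_mem_of_isClosed _ isClosed_localSubalgebra hAl hA1)).mul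
      (hQ.mul (isLocal_mulOp q')), fun x hx => ?_⟩
  have hpx : mulOp p x ∈ tail (fourierLp (T := T) 2) 0 := h3 x hx
  -- As `q'` is coanalytic, it keeps the part discarded by `Q` in the complement of the Hardy space,
  -- so the inner projection may be dropped.
  have k1 : ∀ y, Q (mulOp q' (Q y)) = Q (mulOp q' y) := fun y => by
    have := h4 _ (sub_tailProj_mem 0 y)
    have := tailProj_of_mem_orthogonal this
    change Q (mulOp q' (y - Q y)) = 0 at this
    rw [map_sub, map_sub, sub_eq_zero] at this
    exact this.symm
  have k2 : Q (mulOp q' (mulOp (q * p * (1 - ε)) x)) = (1 - A) (mulOp p x) := by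
    have : q' * (q * p * (1 - ε)) = p - ε * p := by linear_combination (p - ε * p) * h2
    have k : ∀ c d : C(AddCircle T, ℂ), mulOp c (mulOp d x) = mulOp (c * d) x := fun c d => by
      rw [mulOp_mul]; rfl
    rw [k, this, map_sub, sub_apply, mulOp_mul, map_sub, sub_apply, hA]
    simp only [mul_apply_eq_comp, one_apply_eq_self]
    rw [show Q (mulOp p x) = mulOp p x from tailProj_of_mem hpx]
  have k3 : (∑' n : ℕ, A ^ n) ((1 - A) (mulOp p x)) = mulOp p x := by
    rw [← mul_apply_eq_comp (∑' n : ℕ, A ^ n), hinv, one_apply_eq_self]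
  have k4 : mulOp p' (mulOp p x) = x := by
    rw [← mul_apply_eq_comp (mulOp p'), ← mulOp_mul, mul_comm p', h1, mulOp_one, one_apply_eq_self]
  simp only [mul_apply_eq_comp]
  rw [k1, k2, k3, k4]

end Factorization

/-! ### Stability of finite sections -/

section FiniteSections

variable {T : ℝ} [hT : Fact (0 < T)]

/-- The `N × N` Toeplitz matrix of a function on the additive circle. -/
def toeplitzMat (N : ℕ) (b : AddCircle T → ℂ) : Matrix (Fin N) (Fin N) ℂ :=
  Matrix.of fun i j => fourierCoeff b ((i : ℤ) - (j : ℤ))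

variable (T) in
/-- The trigonometric polynomial with given coefficients. -/
def trigPoly {N : ℕ} (x : Fin N → ℂ) : L2 T := ∑ k, x k • fourierLp 2 (k : ℤ)

theorem inner_trigPoly {N : ℕ} (x : Fin N → ℂ) (k : Fin N) :
    inner ℂ (fourierLp 2 (k : ℤ)) (trigPoly T x) = x k :=
  (orthonormal_fourier.comp (fun k : Fin N => (k : ℤ))
    fun _ _ h => by simpa [Fin.ext_iff] using h).inner_right_fintype x k

theorem norm_trigPoly {N : ℕ} (x : Fin N → ℂ) : ‖trigPoly T x‖ = ‖WithLp.toLp 2 x‖ := by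
  have h : Orthonormal ℂ fun k : Fin N => fourierLp (T := T) 2 (k : ℤ) :=
    orthonormal_fourier.comp (fun k : Fin N => (k : ℤ))
      fun _ _ h => by simpa [Fin.ext_iff] using h
  have h1 : inner ℂ (trigPoly T x) (trigPoly T x) = ((‖WithLp.toLp 2 x‖ ^ 2 : ℝ) : ℂ) := by
    rw [trigPoly, h.inner_sum, EuclideanSpace.norm_sq_eq]
    push_cast
    refine Finset.sum_congr rfl fun k _ => ?_
    rw [Complex.conj_mul']
  rw [inner_self_eq_norm_sq_to_K] at h1
  have h2 : ‖trigPoly T x‖ ^ 2 = ‖WithLp.toLp 2 x‖ ^ 2 :=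
    Complex.ofReal_injective (by simpa using h1)
  exact (sq_eq_sq₀ (norm_nonneg _) (norm_nonneg _)).1 h2

theorem trigPoly_mem_tail {N : ℕ} (x : Fin N → ℂ) :
    trigPoly T x ∈ tail (fourierLp (T := T) 2) 0 :=
  Submodule.sum_mem _ fun k _ => Submodule.smul_mem _ _
    (Orthonormal.mem_tail orthonormal_fourier (by positivity))

theorem inner_mulOp_trigPoly (b : C(AddCircle T, ℂ)) {N : ℕ} (x : Fin N → ℂ) (i : ℤ) :
    inner ℂ (fourierLp 2 i) (mulOp b (trigPoly T x)) =
      ∑ j : Fin N, fourierCoeff b (i - j) * x j := by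
  rw [trigPoly, map_sum, inner_sum]
  refine Finset.sum_congr rfl fun j _ => ?_
  rw [map_smul, inner_smul_right, inner_fourierLp_mulOp, mul_comm]

theorem inner_mulOp_trigPoly_fin (b : C(AddCircle T, ℂ)) {N : ℕ} (x : Fin N → ℂ) (i : Fin N) :
    inner ℂ (fourierLp 2 (i : ℤ)) (mulOp b (trigPoly T x)) = (toeplitzMat N b).mulVec x i :=
  inner_mulOp_trigPoly b x i

/-- Bessel's inequality for finitely many coordinates. -/
theorem norm_toLp_le_of_inner {N : ℕ} (y : L2 T) (z : Fin N → ℂ)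
    (h : ∀ k : Fin N, z k = 0 ∨ z k = inner ℂ (fourierLp 2 (k : ℤ)) y) :
    ‖WithLp.toLp 2 z‖ ≤ ‖y‖ := by
  have ho : Orthonormal ℂ fun k : Fin N => fourierLp (T := T) 2 (k : ℤ) :=
    orthonormal_fourier.comp (fun k : Fin N => (k : ℤ))
      fun _ _ h => by simpa [Fin.ext_iff] using h
  refine (sq_le_sq₀ (norm_nonneg _) (norm_nonneg _)).1 ?_
  rw [EuclideanSpace.norm_sq_eq]
  refine (Finset.sum_le_sum fun k _ => ?_).trans (ho.sum_inner_products_le y (s := Finset.univ))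
  rcases h k with h | h
  · simp [h]
  · simp [h]

theorem norm_toeplitzMat_mulVec_le (b : C(AddCircle T, ℂ)) {N : ℕ} (x : Fin N → ℂ) :
    ‖WithLp.toLp 2 ((toeplitzMat N b).mulVec x)‖ ≤ ‖b‖ * ‖WithLp.toLp 2 x‖ := by
  refine (norm_toLp_le_of_inner (mulOp b (trigPoly T x)) _ fun k =>
    .inr (inner_mulOp_trigPoly_fin b x k).symm).trans ?_
  rw [← norm_trigPoly (T := T) x]
  exact ((mulOp b).le_opNorm _).trans (mul_le_mul_of_nonneg_right (norm_mulOp_le b) (norm_nonneg _))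

theorem toeplitzMat_add (b c : C(AddCircle T, ℂ)) (N : ℕ) :
    toeplitzMat N (b + c : C(AddCircle T, ℂ)) = toeplitzMat N b + toeplitzMat N c := by
  ext i j
  simp only [toeplitzMat, Matrix.of_apply, Matrix.add_apply, ContinuousMap.coe_add]
  rw [fourierCoeff.add]
  · rfl
  · exact b.continuous.integrable_of_hasCompactSupport (HasCompactSupport.of_compactSpace _)
  · exact c.continuous.integrable_of_hasCompactSupport (HasCompactSupport.of_compactSpace _)

/-- The components of `x` away from the end are controlled by the Toeplitz matrix. -/
theorem exists_norm_initial_le {b : C(AddCircle T, ℂ)} (hb : b ∈ evenSubalgebra T) (h : IsUnit b)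
    {η : ℝ} (hη : 0 < η) :
    ∃ (D : ℕ) (K : ℝ), 0 < K ∧ ∀ (N : ℕ) (x : Fin N → ℂ),
      ‖WithLp.toLp 2 (fun k : Fin N => if (k : ℕ) + D < N then x k else 0)‖ ≤
        K * ‖WithLp.toLp 2 ((toeplitzMat N b).mulVec x)‖ + η * ‖WithLp.toLp 2 x‖ := by
  obtain ⟨G, hG, hG1⟩ := exists_isLocal_leftInverse hb h
  obtain ⟨D, hD⟩ := hG (η / (‖b‖ + 1)) (by positivity)
  refine ⟨D, ‖G‖ + η / (‖b‖ + 1), by positivity, fun N x => ?_⟩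
  set X := trigPoly T x with hX
  set r := trigPoly T ((toeplitzMat N b).mulVec x) with hr
  set w := tailProj (fourierLp 2) 0 (mulOp b X) - r with hw
  -- In coordinates `0, …, N - 1` the projected product and `r` agree, so `w` starts at `N`. Up to a
  -- small error, `G` carries it back by at most `D` places.
  have hwN : w ∈ tail (fourierLp (T := T) 2) N := by
    refine mem_tail.2 fun j hj => ?_
    by_cases h0 : j < 0
    · exact mem_tail.1 (sub_mem (tailProj_mem 0 _) (trigPoly_mem_tail _)) j h0
    · lift j to ℕ using not_lt.1 h0
      have h1 := inner_mulOp_trigPoly_fin b x ⟨j, by exact_mod_cast hj⟩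
      have h2 := inner_trigPoly (T := T) ((toeplitzMat N b).mulVec x) ⟨j, by exact_mod_cast hj⟩
      rw [hw, inner_sub_right, inner_tailProj orthonormal_fourier (not_lt.1 h0), sub_eq_zero]
      exact h1.trans h2.symm
  obtain ⟨y, hy, hy'⟩ := hD N w hwN
  have hGX : G r + G w = X := by
    rw [← map_add, hw, add_sub_cancel]
    exact hG1 X (trigPoly_mem_tail x)
  have h1 : ‖WithLp.toLp 2 (fun k : Fin N => if (k : ℕ) + D < N then x k else 0)‖ ≤ ‖X - y‖ := by
    refine norm_toLp_le_of_inner _ _ fun k => ?_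
    by_cases hk : (k : ℕ) + D < N
    · right
      rw [if_pos hk, inner_sub_right, inner_trigPoly, mem_tail.1 hy _ (by omega), sub_zero]
    · left
      rw [if_neg hk]
  have h2 : ‖w‖ ≤ ‖b‖ * ‖X‖ + ‖r‖ := by
    refine (norm_sub_le _ _).trans (add_le_add_left ?_ _)
    refine ((tailProj (fourierLp 2) 0).le_opNorm _).trans ?_
    refine (mul_le_of_le_one_left (norm_nonneg _) (norm_tailProj_le 0)).trans ?_
    exact ((mulOp b).le_opNorm _).trans
      (mul_le_mul_of_nonneg_right (norm_mulOp_le b) (norm_nonneg _))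
  have h3 : ‖X - y‖ ≤ ‖G‖ * ‖r‖ + η / (‖b‖ + 1) * ‖w‖ := by
    have : X - y = G r + (G w - y) := by rw [← hGX]; abel
    rw [this]
    exact norm_add_le_of_le (G.le_opNorm r) hy'
  have h4 : η / (‖b‖ + 1) * ‖b‖ ≤ η := by
    rw [div_mul_eq_mul_div, div_le_iff₀ (by positivity)]
    nlinarith [norm_nonneg b]
  rw [← norm_trigPoly (T := T) x, ← norm_trigPoly (T := T) ((toeplitzMat N b).mulVec x), ← hX, ← hr]
  calc _ ≤ ‖G‖ * ‖r‖ + η / (‖b‖ + 1) * (‖b‖ * ‖X‖ + ‖r‖) :=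
        h1.trans (h3.trans (by gcongr))
    _ = (‖G‖ + η / (‖b‖ + 1)) * ‖r‖ + (η / (‖b‖ + 1) * ‖b‖) * ‖X‖ := by ring
    _ ≤ _ := by gcongr

/-- Reversal turns the index difference `i - j` into `j - i`, and the coefficients of an even
function do not notice. -/
theorem toeplitzMat_mulVec_rev {b : AddCircle T → ℂ} (hb : ∀ x, b (-x) = b x) {N : ℕ}
    (x : Fin N → ℂ) :
    (toeplitzMat N b).mulVec (x ∘ Fin.rev) = (toeplitzMat N b).mulVec x ∘ Fin.rev := by
  ext i
  simp only [Matrix.mulVec, dotProduct, Function.comp_apply, toeplitzMat, Matrix.of_apply]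
  rw [← Equiv.sum_comp Fin.revPerm]
  refine Finset.sum_congr rfl fun j _ => ?_
  rw [Fin.revPerm_apply, Fin.rev_rev, ← fourierCoeff_neg_of_even hb]
  congr 2
  rw [Fin.val_rev, Fin.val_rev]
  omega

theorem norm_toLp_comp_rev {N : ℕ} (x : Fin N → ℂ) :
    ‖WithLp.toLp 2 (x ∘ Fin.rev)‖ = ‖WithLp.toLp 2 x‖ := by
  rw [EuclideanSpace.norm_eq, EuclideanSpace.norm_eq]
  congr 1
  exact Equiv.sum_comp Fin.revPerm fun i => ‖x i‖ ^ 2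

/-- Stability of the finite sections, for an even symbol without zeros. -/
theorem exists_norm_le_toeplitzMat {b : C(AddCircle T, ℂ)} (hb : b ∈ evenSubalgebra T)
    (h : IsUnit b) :
    ∃ (N₀ : ℕ) (K : ℝ), 0 < K ∧ ∀ N ≥ N₀, ∀ x : Fin N → ℂ,
      ‖WithLp.toLp 2 x‖ ≤ K * ‖WithLp.toLp 2 ((toeplitzMat N b).mulVec x)‖ := by
  obtain ⟨D, K, hK, hD⟩ := exists_norm_initial_le hb h (η := 1 / 4) (by norm_num)
  -- For `N ≥ 2 D` each index is at distance more than `D - 1` from one of the ends, so `x` and its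
  -- reversal together cover all coordinates. Two errors of `1/4` leave half of `‖x‖`, whence `4 *
  -- K`.
  refine ⟨2 * D, 4 * K, by positivity, fun N hN x => ?_⟩
  have h1 := hD N x
  have h2 := hD N (x ∘ Fin.rev)
  rw [toeplitzMat_mulVec_rev (apply_neg_of_mem_evenSubalgebra hb), norm_toLp_comp_rev,
    norm_toLp_comp_rev] at h2
  set A := ‖WithLp.toLp 2 (fun k : Fin N => if (k : ℕ) + D < N then x k else 0)‖ with hA
  set B := ‖WithLp.toLp 2 (fun k : Fin N => if (k : ℕ) + D < N then (x ∘ Fin.rev) k else 0)‖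
    with hB
  have h3 : ‖WithLp.toLp 2 x‖ ^ 2 ≤ A ^ 2 + B ^ 2 := by
    rw [hA, hB, EuclideanSpace.norm_sq_eq, EuclideanSpace.norm_sq_eq, EuclideanSpace.norm_sq_eq]
    rw [← Equiv.sum_comp Fin.revPerm fun k => ‖WithLp.toLp 2
      (fun k : Fin N => if (k : ℕ) + D < N then (x ∘ Fin.rev) k else 0) k‖ ^ 2,
      ← Finset.sum_add_distrib]
    refine Finset.sum_le_sum fun k _ => ?_
    simp only [Fin.revPerm_apply, Function.comp_apply, Fin.rev_rev, Fin.val_rev]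
    split_ifs with h4 h5 h5
    · exact le_add_of_nonneg_right (by positivity)
    · exact le_add_of_nonneg_right (by positivity)
    · exact le_add_of_nonneg_left (by positivity)
    · omega
  have hA0 : 0 ≤ A := norm_nonneg _
  have hB0 : 0 ≤ B := norm_nonneg _
  have h4 : ‖WithLp.toLp 2 x‖ ≤ A + B := by
    refine (sq_le_sq₀ (norm_nonneg _) (by positivity)).1 (h3.trans ?_)
    nlinarith
  linarith

theorem eventually_norm_le_toeplitzMat {b : C(AddCircle T, ℂ)} (hb : b ∈ evenSubalgebra T)
    (h : IsUnit b) :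
    ∃ (N₀ : ℕ) (K : ℝ), 0 < K ∧ ∀ᶠ c : C(AddCircle T, ℂ) in nhds b, ∀ N ≥ N₀, ∀ x : Fin N → ℂ,
      ‖WithLp.toLp 2 x‖ ≤ K * ‖WithLp.toLp 2 ((toeplitzMat N c).mulVec x)‖ := by
  obtain ⟨N₀, K, hK, hN⟩ := exists_norm_le_toeplitzMat hb h
  refine ⟨N₀, 2 * K, by positivity, ?_⟩
  -- In this ball the perturbation costs at most half of `‖x‖`, which doubles the constant.
  filter_upwards [Metric.ball_mem_nhds b (ε := 1 / (2 * K)) (by positivity)] with c hc N hN' x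
  rw [Metric.mem_ball, dist_comm, dist_eq_norm, lt_div_iff₀ (by positivity)] at hc
  have h1 := hN N hN' x
  have h2 := norm_toeplitzMat_mulVec_le (b - c) x
  have h3 : toeplitzMat N b = toeplitzMat N c + toeplitzMat N (b - c : C(AddCircle T, ℂ)) := by
    rw [← toeplitzMat_add, add_sub_cancel]
  rw [h3, Matrix.add_mulVec, WithLp.toLp_add] at h1
  have h4 := norm_add_le (WithLp.toLp 2 ((toeplitzMat N c).mulVec x))
    (WithLp.toLp 2 ((toeplitzMat N (b - c : C(AddCircle T, ℂ))).mulVec x))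
  have h5 := h1.trans (mul_le_mul_of_nonneg_left (h4.trans (add_le_add_right h2 _)) hK.le)
  nlinarith [norm_nonneg (WithLp.toLp 2 x), norm_nonneg (b - c)]

theorem isUnit_and_norm_inv_le {N : ℕ} {A : Matrix (Fin N) (Fin N) ℂ} {K : ℝ} (hK : 0 ≤ K)
    (h : ∀ x : Fin N → ℂ, ‖WithLp.toLp 2 x‖ ≤ K * ‖WithLp.toLp 2 (A.mulVec x)‖) :
    IsUnit A ∧ ‖Matrix.toEuclideanCLM (𝕜 := ℂ) A⁻¹‖ ≤ K := by
  have hA : IsUnit A := by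
    rw [← Matrix.mulVec_injective_iff_isUnit]
    intro x y hxy
    have h1 := h (x - y)
    rw [Matrix.mulVec_sub, hxy, sub_self, WithLp.toLp_zero, norm_zero, mul_zero] at h1
    have h2 := norm_le_zero_iff.1 h1
    rw [WithLp.toLp_eq_zero, sub_eq_zero] at h2
    exact h2
  refine ⟨hA, ContinuousLinearMap.opNorm_le_bound _ hK fun y => ?_⟩
  have h1 := h (A⁻¹.mulVec y.ofLp)
  rw [Matrix.mulVec_mulVec, Matrix.mul_nonsing_inv _ ((Matrix.isUnit_iff_isUnit_det A).1 hA),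
    Matrix.one_mulVec] at h1
  exact h1

end FiniteSections

/-! ### Divided differences in a commutative Banach algebra -/

section DividedDifference

variable {𝓑 : Type*} [NormedCommRing 𝓑] [NormedAlgebra ℂ 𝓑]

/-- The divided difference of `t ^ j + t ^ (-j)` as a function of `τ = t + t⁻¹`, the second node
being `w + w⁻¹`. -/
def divDiff (τ : 𝓑) (w : ℂ) : ℕ → 𝓑
  | 0 => 0
  | 1 => 1
  | j + 2 => τ * divDiff τ w (j + 1) - divDiff τ w j +
      algebraMap ℂ 𝓑 (w ^ (j + 1) + (w⁻¹) ^ (j + 1))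

/-- Induction on the two-step recurrence of `t ^ j + u ^ j`. Stating it in an algebra covers both
point values and continuous functions on the circle. -/
theorem sub_mul_divDiff {t u : 𝓑} (htu : t * u = 1) {w : ℂ} (hw : w ≠ 0) (j : ℕ) :
    (t + u - algebraMap ℂ 𝓑 (w + w⁻¹)) * divDiff (t + u) w j =
      t ^ j + u ^ j - algebraMap ℂ 𝓑 (w ^ j + (w⁻¹) ^ j) := by
  have hww : algebraMap ℂ 𝓑 w * algebraMap ℂ 𝓑 w⁻¹ = 1 := by
    rw [← map_mul, mul_inv_cancel₀ hw, map_one]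
  induction j using Nat.twoStepInduction with
  | zero => simp only [divDiff, pow_zero, mul_zero, map_add, map_one]; ring
  | one => simp [divDiff]
  | more j h1 h2 =>
    simp only [divDiff, map_add, map_pow] at h1 h2 ⊢
    linear_combination (t + u) * h2 - h1 + (t ^ j + u ^ j) * htu -
      (algebraMap ℂ 𝓑 w ^ j + algebraMap ℂ 𝓑 w⁻¹ ^ j) * hww

theorem norm_divDiff_le [NormOneClass 𝓑] {t u : 𝓑} (htu : t * u = 1) {w : ℂ} {q : ℝ} (hq : 1 ≤ q)
    (ht : ‖t‖ ≤ q) (hu : ‖u‖ ≤ q) (hw : ‖w‖ ≤ q) (hw' : ‖w⁻¹‖ ≤ q) (j : ℕ) :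
    ‖divDiff (t + u) w j‖ ≤ 2 * (j : ℝ) ^ 2 * q ^ j := by
  have hq0 : 0 ≤ q := zero_le_one.trans hq
  -- Subtracting `t` times the previous term factors the second-order recurrence into two
  -- first-order ones, with multipliers `u` and `t`. Each summation costs one factor of order `j`,
  -- which avoids exponential growth in `j` when `q = 1`.
  have hR : ∀ j : ℕ, ‖divDiff (t + u) w (j + 1) - t * divDiff (t + u) w j‖ ≤
      2 * ((j : ℝ) + 1) * q ^ j := by
    intro j
    induction j with
    | zero => simp [divDiff]
    | succ j ih =>
      have h1 : divDiff (t + u) w (j + 1 + 1) - t * divDiff (t + u) w (j + 1) =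
          u * (divDiff (t + u) w (j + 1) - t * divDiff (t + u) w j) +
            algebraMap ℂ 𝓑 (w ^ (j + 1) + (w⁻¹) ^ (j + 1)) := by
        simp only [divDiff]
        linear_combination divDiff (t + u) w j * htu
      have h2 : ‖algebraMap ℂ 𝓑 (w ^ (j + 1) + (w⁻¹) ^ (j + 1))‖ ≤ q ^ (j + 1) + q ^ (j + 1) := by
        rw [norm_algebraMap']
        refine norm_add_le_of_le ?_ ?_
        · rw [norm_pow]; gcongr
        · rw [norm_pow]; gcongr
      rw [h1]
      calc _ ≤ q * (2 * ((j : ℝ) + 1) * q ^ j) + (q ^ (j + 1) + q ^ (j + 1)) :=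
            norm_add_le_of_le ((norm_mul_le _ _).trans (by gcongr)) h2
        _ = 2 * (((j + 1 : ℕ) : ℝ) + 1) * q ^ (j + 1) := by push_cast; ring
  induction j with
  | zero => simp [divDiff]
  | succ j ih =>
    have h1 : divDiff (t + u) w (j + 1) = t * divDiff (t + u) w j +
        (divDiff (t + u) w (j + 1) - t * divDiff (t + u) w j) := by ring
    have h3 : q ^ j ≤ q ^ (j + 1) := pow_le_pow_right₀ hq (Nat.le_succ j)
    rw [h1]
    calc _ ≤ q * (2 * (j : ℝ) ^ 2 * q ^ j) + 2 * ((j : ℝ) + 1) * q ^ j :=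
          norm_add_le_of_le ((norm_mul_le _ _).trans (by gcongr)) (hR j)
      _ ≤ 2 * (j : ℝ) ^ 2 * q ^ (j + 1) + 2 * ((j : ℝ) + 1) * q ^ (j + 1) := by
          refine add_le_add (le_of_eq (by ring)) (by gcongr)
      _ ≤ 2 * ((j + 1 : ℕ) : ℝ) ^ 2 * q ^ (j + 1) := by
          have h5 : 0 ≤ (j : ℝ) * q ^ (j + 1) := by positivity
          push_cast
          nlinarith

theorem map_divDiff {𝓒 : Type*} [NormedCommRing 𝓒] [NormedAlgebra ℂ 𝓒] (φ : 𝓑 →ₐ[ℂ] 𝓒) (τ : 𝓑)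
    (w : ℂ) (j : ℕ) : φ (divDiff τ w j) = divDiff (φ τ) w j := by
  induction j using Nat.twoStepInduction with
  | zero => simp [divDiff]
  | one => simp [divDiff]
  | more j h1 h2 => simp only [divDiff, map_add, map_sub, map_mul, h1, h2, AlgHom.commutes]

theorem divDiff_mem {S : Subalgebra ℂ 𝓑} {τ : 𝓑} (hτ : τ ∈ S) (w : ℂ) (j : ℕ) :
    divDiff τ w j ∈ S := by
  induction j using Nat.twoStepInduction with
  | zero => exact zero_mem _
  | one => exact one_mem _
  | more j h1 h2 =>
    exact add_mem (sub_mem (mul_mem hτ h2) h1) (Subalgebra.algebraMap_mem _ _)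

theorem tendsto_divDiff {ι : Type*} {F : Filter ι} {τ : ι → 𝓑} {w : ι → ℂ} {τ₀ : 𝓑} {w₀ : ℂ}
    (hτ : Filter.Tendsto τ F (nhds τ₀)) (hw : Filter.Tendsto w F (nhds w₀)) (h0 : w₀ ≠ 0)
    (j : ℕ) : Filter.Tendsto (fun i => divDiff (τ i) (w i) j) F (nhds (divDiff τ₀ w₀ j)) := by
  induction j using Nat.twoStepInduction with
  | zero => exact tendsto_const_nhds
  | one => exact tendsto_const_nhds
  | more j h1 h2 =>
    refine ((hτ.mul h2).sub h1).add ?_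
    exact ((continuous_algebraMap ℂ 𝓑).tendsto _).comp
      ((hw.pow (j + 1)).add ((hw.inv₀ h0).pow (j + 1)))

/-- The partial sums of the divided difference of an even function with Fourier coefficients `A`,
with the sign of `b`. -/
def symbolN (A : ℕ → ℂ) (n : ℕ) (τ : 𝓑) (w : ℂ) : 𝓑 :=
  -∑ j ∈ Finset.range n, A j • divDiff τ w j

/-- The limit of `symbolN`. -/
def symbol (A : ℕ → ℂ) (τ : 𝓑) (w : ℂ) : 𝓑 := -∑' j, A j • divDiff τ w j

/-- Dominated convergence with majorant `2 K ‖A j‖ j²`. The nodes may leave the unit circle, but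
only powers below `n i` occur, and these are bounded by `q i ^ n i ≤ K`. -/
theorem tendsto_symbolN [NormOneClass 𝓑] [CompleteSpace 𝓑] {A : ℕ → ℂ}
    (hA : Summable fun j : ℕ => ‖A j‖ * (j : ℝ) ^ 2) {ι : Type*} {F : Filter ι} {n : ι → ℕ}
    (hn : Filter.Tendsto n F Filter.atTop) {t u : ι → 𝓑} {w : ι → ℂ} {τ₀ : 𝓑} {w₀ : ℂ}
    (hτ : Filter.Tendsto (fun i => t i + u i) F (nhds τ₀)) (hw : Filter.Tendsto w F (nhds w₀))
    (h0 : w₀ ≠ 0) (htu : ∀ i, t i * u i = 1) {q : ι → ℝ} {K : ℝ} (hq : ∀ i, 1 ≤ q i)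
    (hK : ∀ i, q i ^ n i ≤ K) (h1 : ∀ i, ‖t i‖ ≤ q i) (h2 : ∀ i, ‖u i‖ ≤ q i)
    (h3 : ∀ i, ‖w i‖ ≤ q i) (h4 : ∀ i, ‖(w i)⁻¹‖ ≤ q i) :
    Filter.Tendsto (fun i => symbolN A (n i) (t i + u i) (w i)) F (nhds (symbol A τ₀ w₀)) := by
  have key : Filter.Tendsto (fun i => ∑' j, if j < n i then A j • divDiff (t i + u i) (w i) j
      else 0) F (nhds (∑' j, A j • divDiff τ₀ w₀ j)) := by
    refine tendsto_tsum_of_dominated_convergence (hA.mul_left (2 * K)) (fun j => ?_)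
      (.of_forall fun i j => ?_)
    · refine ((tendsto_divDiff hτ hw h0 j).const_smul (A j)).congr' ?_
      filter_upwards [hn.eventually_gt_atTop j] with i hi
      rw [if_pos hi]
    · have hK0 : 0 ≤ K := (pow_nonneg (zero_le_one.trans (hq i)) _).trans (hK i)
      split_ifs with hj
      · rw [norm_smul]
        have h5 := norm_divDiff_le (htu i) (hq i) (h1 i) (h2 i) (h3 i) (h4 i) j
        have h6 : q i ^ j ≤ K := (pow_le_pow_right₀ (hq i) hj.le).trans (hK i)
        calc _ ≤ ‖A j‖ * (2 * (j : ℝ) ^ 2 * K) := by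
              refine mul_le_mul_of_nonneg_left (h5.trans ?_) (norm_nonneg _)
              gcongr
          _ = _ := by ring
      · rw [norm_zero]; positivity
  refine key.neg.congr fun i => ?_
  rw [symbolN, tsum_eq_sum (s := Finset.range (n i))]
  · congr 1
    refine Finset.sum_congr rfl fun j hj => ?_
    rw [if_pos (Finset.mem_range.1 hj)]
  · intro j hj
    rw [if_neg (by simpa using hj)]

theorem summable_smul_divDiff [NormOneClass 𝓑] [CompleteSpace 𝓑] {A : ℕ → ℂ}
    (hA : Summable fun j : ℕ => ‖A j‖ * (j : ℝ) ^ 2) {t u : 𝓑} {w : ℂ} (htu : t * u = 1)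
    (ht : ‖t‖ ≤ 1) (hu : ‖u‖ ≤ 1) (hw : ‖w‖ = 1) :
    Summable fun j => A j • divDiff (t + u) w j := by
  refine .of_norm_bounded (hA.mul_left 2) fun j => ?_
  have := norm_divDiff_le htu le_rfl ht hu hw.le (by rw [norm_inv, hw, inv_one]) j
  rw [one_pow, mul_one] at this
  calc _ ≤ ‖A j‖ * (2 * (j : ℝ) ^ 2) := by rw [norm_smul]; gcongr
    _ = _ := by ring

theorem tendsto_symbol [NormOneClass 𝓑] [CompleteSpace 𝓑] {A : ℕ → ℂ}
    (hA : Summable fun j : ℕ => ‖A j‖ * (j : ℝ) ^ 2) {ι : Type*} {F : Filter ι}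
    {t u : ι → 𝓑} {w : ι → ℂ} {τ₀ : 𝓑} {w₀ : ℂ}
    (hτ : Filter.Tendsto (fun i => t i + u i) F (nhds τ₀)) (hw : Filter.Tendsto w F (nhds w₀))
    (h0 : w₀ ≠ 0) (htu : ∀ i, t i * u i = 1) (h1 : ∀ i, ‖t i‖ ≤ 1) (h2 : ∀ i, ‖u i‖ ≤ 1)
    (h3 : ∀ i, ‖w i‖ = 1) :
    Filter.Tendsto (fun i => symbol A (t i + u i) (w i)) F (nhds (symbol A τ₀ w₀)) := by
  refine (tendsto_tsum_of_dominated_convergence (hA.mul_left 2) (fun j => ?_)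
    (.of_forall fun i j => ?_)).neg
  · exact (tendsto_divDiff hτ hw h0 j).const_smul (A j)
  · have := norm_divDiff_le (htu i) le_rfl (h1 i) (h2 i) (h3 i).le
      (by rw [norm_inv, h3 i, inv_one]) j
    rw [one_pow, mul_one] at this
    calc _ ≤ ‖A j‖ * (2 * (j : ℝ) ^ 2) := by rw [norm_smul]; gcongr
      _ = _ := by ring

theorem map_symbol {𝓒 : Type*} [NormedCommRing 𝓒] [NormedAlgebra ℂ 𝓒] {φ : 𝓑 →ₐ[ℂ] 𝓒}
    (hφ : Continuous φ) {A : ℕ → ℂ} {τ : 𝓑} {w : ℂ} (h : Summable fun j => A j • divDiff τ w j) :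
    φ (symbol A τ w) = symbol A (φ τ) w := by
  rw [symbol, symbol, map_neg, h.map_tsum φ hφ]
  simp [map_divDiff]

theorem symbol_mem {S : Subalgebra ℂ 𝓑} (hS : IsClosed (S : Set 𝓑)) {τ : 𝓑} (hτ : τ ∈ S)
    {A : ℕ → ℂ} {w : ℂ} (h : Summable fun j => A j • divDiff τ w j) : symbol A τ w ∈ S :=
  neg_mem (hS.mem_of_tendsto h.hasSum
    (.of_forall fun _ => sum_mem fun j _ => Subalgebra.smul_mem _ (divDiff_mem hτ w j) _))

theorem map_symbolN {𝓒 : Type*} [NormedCommRing 𝓒] [NormedAlgebra ℂ 𝓒] (φ : 𝓑 →ₐ[ℂ] 𝓒)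
    (A : ℕ → ℂ) (n : ℕ) (τ : 𝓑) (w : ℂ) : φ (symbolN A n τ w) = symbolN A n (φ τ) w := by
  simp [symbolN, map_divDiff]

theorem symbolN_mem {S : Subalgebra ℂ 𝓑} {τ : 𝓑} (hτ : τ ∈ S) (A : ℕ → ℂ) (n : ℕ) (w : ℂ) :
    symbolN A n τ w ∈ S :=
  neg_mem (sum_mem fun j _ => Subalgebra.smul_mem _ (divDiff_mem hτ w j) _)

theorem sub_mul_symbolN {t u : 𝓑} (htu : t * u = 1) {w : ℂ} (hw : w ≠ 0) (A : ℕ → ℂ) (n : ℕ) :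
    (algebraMap ℂ 𝓑 (w + w⁻¹) - (t + u)) * symbolN A n (t + u) w =
      ∑ j ∈ Finset.range n, A j • (t ^ j + u ^ j) -
        algebraMap ℂ 𝓑 (∑ j ∈ Finset.range n, A j * (w ^ j + w⁻¹ ^ j)) := by
  have h : ∀ j, A j • ((t + u - algebraMap ℂ 𝓑 (w + w⁻¹)) * divDiff (t + u) w j) =
      A j • (t ^ j + u ^ j) - algebraMap ℂ 𝓑 (A j * (w ^ j + w⁻¹ ^ j)) := fun j => by
    rw [sub_mul_divDiff htu hw, smul_sub, map_mul, Algebra.smul_def (A j) (algebraMap ℂ 𝓑 _)]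
  rw [map_sum, ← Finset.sum_sub_distrib, ← Finset.sum_congr rfl fun j _ => h j, symbolN,
    ← neg_mul_comm, neg_sub, Finset.mul_sum]
  simp

end DividedDifference

instance fact_two_pi_pos : Fact (0 < 2 * Real.pi) := ⟨Real.two_pi_pos⟩

theorem toCircle_two_pi (φ : ℝ) :
    toCircle ((φ : ℝ) : AddCircle (2 * Real.pi)) = Circle.exp φ := by
  rw [toCircle_apply_mk, div_self Real.two_pi_pos.ne', one_mul]

theorem coeff_eq_fourierCoeff (f : Circle → ℂ) (j : ℤ) :
    coeff f j = fourierCoeff (fun x : AddCircle (2 * Real.pi) => f (toCircle x)) j := rfl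

/-! ### The limit symbol and its zeros -/

section Symbol

variable {α : ℝ} {a : Circle → ℂ}

theorem MemCSL.apply_inv (ha : MemCSL α a) (t : Circle) : a t⁻¹ = a t := by
  obtain ⟨x, rfl⟩ := (AddCircle.homeomorphCircle Real.two_pi_pos.ne').surjective t
  rw [AddCircle.homeomorphCircle_apply]
  obtain ⟨φ, hφ, rfl⟩ := (AddCircle.coe_image_Icc_eq (2 * Real.pi) 0).symm ▸ Set.mem_univ x
  rw [toCircle_two_pi]
  have h := ha.symm φ (by simpa using hφ)
  rw [g, g, Circle.exp_sub, Circle.exp_two_pi, one_div] at h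
  exact h.symm

theorem MemCSL.coeff_neg (ha : MemCSL α a) (j : ℤ) : coeff a (-j) = coeff a j := by
  rw [coeff_eq_fourierCoeff, coeff_eq_fourierCoeff]
  refine fourierCoeff_neg_of_even (fun x => ?_) j
  rw [toCircle_neg, ha.apply_inv]

theorem MemCSL.summable_int (hα : 2 ≤ α) (ha : MemCSL α a) :
    Summable fun j : ℤ => ‖coeff a j‖ * (|(j : ℝ)| + 1) ^ 2 := by
  refine .of_nonneg_of_le (fun j => by positivity) (fun j => ?_) ha.memWiener.2
  gcongr
  rw [← Real.rpow_natCast]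
  refine Real.rpow_le_rpow_of_exponent_le ?_ (by exact_mod_cast hα)
  linarith [abs_nonneg (j : ℝ)]

theorem MemCSL.summable_coeff (hα : 2 ≤ α) (ha : MemCSL α a) : Summable (coeff a) := by
  refine .of_norm_bounded (ha.summable_int hα) fun j => ?_
  refine le_mul_of_one_le_right (norm_nonneg _) ?_
  nlinarith [abs_nonneg (j : ℝ)]

variable (a) in
/-- The Fourier coefficients with nonnegative index. -/
def natCoeff (j : ℕ) : ℂ := coeff a (j : ℤ)

theorem MemCSL.summable_natCoeff (hα : 2 ≤ α) (ha : MemCSL α a) :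
    Summable fun j : ℕ => ‖natCoeff a j‖ * (j : ℝ) ^ 2 := by
  refine .of_nonneg_of_le (fun j => by positivity) (fun j => ?_)
    ((ha.summable_int hα).comp_injective Nat.cast_injective)
  simp only [Function.comp_apply, natCoeff, Int.cast_natCast, Nat.abs_cast]
  gcongr
  linarith

/-- The sum counts index `0` twice, once for each power; hence the subtracted term. -/
theorem MemCSL.aN_eq (ha : MemCSL α a) {n : ℕ} (hn : 1 ≤ n) (z : ℂ) :
    aN a n z = ∑ j ∈ Finset.range n, natCoeff a j * (z ^ j + z⁻¹ ^ j) - natCoeff a 0 := by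
  induction n, hn using Nat.le_induction with
  | base =>
    simp [aN, natCoeff]
    ring
  | succ n hn ih =>
    have h : Finset.Icc (-(((n + 1 : ℕ) : ℤ) - 1)) (((n + 1 : ℕ) : ℤ) - 1) =
        insert (n : ℤ) (insert (-n : ℤ) (Finset.Icc (-((n : ℤ) - 1)) ((n : ℤ) - 1))) := by
      ext k
      simp only [Finset.mem_Icc, Finset.mem_insert]
      omega
    rw [aN] at ih
    rw [aN, h, Finset.sum_insert, Finset.sum_insert, ih, Finset.sum_range_succ, ha.coeff_neg,
      zpow_neg, zpow_natCast, natCoeff, natCoeff, inv_pow]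
    · ring
    · simp only [Finset.mem_Icc]; omega
    · simp only [Finset.mem_Icc, Finset.mem_insert]; omega

theorem MemCSL.aN_sub_aN (ha : MemCSL α a) {n : ℕ} (hn : 1 ≤ n) {z w : ℂ} (hz : z ≠ 0)
    (hw : w ≠ 0) :
    aN a n z - aN a n w =
      (w + w⁻¹ - (z + z⁻¹)) * symbolN (natCoeff a) n (z + z⁻¹) w := by
  have h := sub_mul_symbolN (mul_inv_cancel₀ hz) hw (natCoeff a) n
  simp only [Algebra.algebraMap_self, RingHom.id_apply, smul_eq_mul] at h
  rw [h, ha.aN_eq hn, ha.aN_eq hn]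
  ring

theorem MemCSL.tendsto_aN (hα : 2 ≤ α) (ha : MemCSL α a) (φ : ℝ) :
    Filter.Tendsto (fun n => aN a n (Circle.exp φ)) Filter.atTop (nhds (g a φ)) := by
  let f : C(AddCircle (2 * Real.pi), ℂ) :=
    ⟨fun x => a (toCircle x), ha.memWiener.1.comp continuous_toCircle⟩
  have h1 := has_pointwise_sum_fourier_series_of_summable (f := f) (ha.summable_coeff hα) (φ : ℝ)
  have h2 := h1.nat_add_neg.tendsto_sum_nat.sub_const (natCoeff a 0)
  have h3 : ∀ j : ℤ, fourierCoeff f j = coeff a j := fun j => rfl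
  have h4 : f (φ : ℝ) = g a φ := by
    change a (toCircle (φ : AddCircle (2 * Real.pi))) = _
    rw [toCircle_two_pi]; rfl
  have h5 : (fourier 0) ((φ : ℝ) : AddCircle (2 * Real.pi)) = 1 := fourier_zero
  simp only [h3, h4, h5, smul_eq_mul, mul_one, natCoeff, Nat.cast_zero, add_sub_cancel_right]
    at h2
  refine h2.congr' ?_
  filter_upwards [Filter.eventually_ge_atTop 1] with n hn
  rw [ha.aN_eq hn, natCoeff, Nat.cast_zero]
  congr 1
  refine Finset.sum_congr rfl fun j _ => ?_
  have h6 : ∀ k : ℤ, (fourier k) ((φ : ℝ) : AddCircle (2 * Real.pi)) =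
      (Circle.exp φ : ℂ) ^ k := fun k => by
    rw [fourier_apply, toCircle_zsmul, toCircle_two_pi, Circle.coe_zpow]
  rw [h6, h6, ha.coeff_neg, zpow_neg, zpow_natCast, natCoeff, inv_pow]
  ring

theorem exp_add_inv (φ : ℝ) :
    (Circle.exp φ : ℂ) + (Circle.exp φ : ℂ)⁻¹ = ((2 * Real.cos φ : ℝ) : ℂ) := by
  rw [Circle.coe_exp, ← Complex.exp_neg, Complex.ofReal_mul, Complex.ofReal_cos, Complex.cos]
  push_cast
  ring_nf

theorem norm_circle_inv_le (z : Circle) : ‖(z : ℂ)⁻¹‖ ≤ 1 := by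
  rw [norm_inv, Circle.norm_coe, inv_one]

/-- The limit of `MemCSL.aN_sub_aN` on the unit circle, where all powers are bounded by `1`. -/
theorem MemCSL.g_sub_g (hα : 2 ≤ α) (ha : MemCSL α a) (φ ψ : ℝ) :
    g a φ - g a ψ = ((2 * Real.cos ψ - 2 * Real.cos φ : ℝ) : ℂ) *
      symbol (natCoeff a) ((2 * Real.cos φ : ℝ) : ℂ) (Circle.exp ψ) := by
  have h1 := tendsto_symbolN (𝓑 := ℂ) (ha.summable_natCoeff hα) (F := Filter.atTop) (n := id)
    Filter.tendsto_id (t := fun _ => (Circle.exp φ : ℂ)) (u := fun _ => (Circle.exp φ : ℂ)⁻¹)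
    (w := fun _ => (Circle.exp ψ : ℂ)) tendsto_const_nhds tendsto_const_nhds (Circle.coe_ne_zero _)
    (fun _ => mul_inv_cancel₀ (Circle.coe_ne_zero _)) (q := fun _ => 1) (K := 1) (fun _ => le_rfl)
    (fun _ => (one_pow _).le) (fun _ => (Circle.norm_coe _).le)
    (fun _ => norm_circle_inv_le _) (fun _ => (Circle.norm_coe _).le)
    (fun _ => norm_circle_inv_le _)
  have h2 := (ha.tendsto_aN hα φ).sub (ha.tendsto_aN hα ψ)
  have h3 := h1.const_mul ((Circle.exp ψ : ℂ) + (Circle.exp ψ : ℂ)⁻¹ -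
    ((Circle.exp φ : ℂ) + (Circle.exp φ : ℂ)⁻¹))
  refine tendsto_nhds_unique h2 ?_
  rw [exp_add_inv, exp_add_inv, ← Complex.ofReal_sub] at h3
  refine h3.congr' ?_
  filter_upwards [Filter.eventually_ge_atTop 1] with n hn
  rw [ha.aN_sub_aN hn (Circle.coe_ne_zero _) (Circle.coe_ne_zero _), exp_add_inv, exp_add_inv,
    ← Complex.ofReal_sub]
  rfl

theorem continuous_coe_circle_exp : Continuous fun φ : ℝ => (Circle.exp φ : ℂ) :=
  continuous_subtype_val.comp Circle.exp.continuous

theorem continuous_symbol {A : ℕ → ℂ} (hA : Summable fun j : ℕ => ‖A j‖ * (j : ℝ) ^ 2) :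
    Continuous fun p : ℝ × ℝ => symbol A ((2 * Real.cos p.1 : ℝ) : ℂ) (Circle.exp p.2) := by
  refine continuous_iff_continuousAt.2 fun p => ?_
  have h := tendsto_symbol (𝓑 := ℂ) hA (F := nhds p) (t := fun p => (Circle.exp p.1 : ℂ))
    (u := fun p => (Circle.exp p.1 : ℂ)⁻¹) (w := fun p => (Circle.exp p.2 : ℂ))
    (τ₀ := (Circle.exp p.1 : ℂ) + (Circle.exp p.1 : ℂ)⁻¹) (w₀ := (Circle.exp p.2 : ℂ))
    ?_ ?_ (Circle.coe_ne_zero _) (fun _ => mul_inv_cancel₀ (Circle.coe_ne_zero _))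
    (fun _ => (Circle.norm_coe _).le) (fun _ => norm_circle_inv_le _)
    (fun _ => Circle.norm_coe _)
  · simp only [exp_add_inv] at h
    exact h
  · have h1 : Continuous fun p : ℝ × ℝ => (Circle.exp p.1 : ℂ) :=
      continuous_coe_circle_exp.comp continuous_fst
    exact (h1.add (h1.inv₀ fun _ => Circle.coe_ne_zero _)).continuousAt
  · exact (continuous_coe_circle_exp.comp continuous_snd).continuousAt

/-- At a zero of `h` continuity of `k` suffices. Thus `g'`, and `g''` at the end points, can be
computed without differentiating the symbol. -/
theorem hasDerivAt_mul_of_eq_zero {h k : ℝ → ℂ} {h' : ℂ} {x : ℝ} (hh : HasDerivAt h h' x)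
    (h0 : h x = 0) (hk : ContinuousAt k x) : HasDerivAt (fun y => h y * k y) (h' * k x) x := by
  rw [hasDerivAt_iff_tendsto_slope] at hh ⊢
  refine (hh.mul (hk.tendsto.mono_left nhdsWithin_le_nhds)).congr fun y => ?_
  simp only [slope_def_module, h0, zero_mul, sub_zero, smul_mul_assoc]

theorem MemCSL.hasDerivAt_g (hα : 2 ≤ α) (ha : MemCSL α a) (φ : ℝ) :
    HasDerivAt (g a) (((2 * Real.sin φ : ℝ) : ℂ) *
      symbol (natCoeff a) ((2 * Real.cos φ : ℝ) : ℂ) (Circle.exp φ)) φ := by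
  have hc := continuous_symbol (ha.summable_natCoeff hα)
  have h1 : HasDerivAt (fun σ : ℝ => ((2 * Real.cos φ - 2 * Real.cos σ : ℝ) : ℂ))
      ((2 * Real.sin φ : ℝ) : ℂ) φ := by
    have := (((Real.hasDerivAt_cos φ).const_mul 2).const_sub (2 * Real.cos φ)).ofReal_comp
    simpa using this
  have h2 := (hasDerivAt_mul_of_eq_zero h1 (by simp)
    (hc.comp (continuous_id.prodMk continuous_const)).continuousAt (k := fun σ : ℝ =>
      symbol (natCoeff a) ((2 * Real.cos σ : ℝ) : ℂ) (Circle.exp φ))).add_const (g a φ)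
  refine h2.congr_of_eventuallyEq (.of_forall fun σ => ?_)
  exact eq_add_of_sub_eq (ha.g_sub_g hα σ φ)

theorem MemCSL.iteratedDeriv_two_g (hα : 2 ≤ α) (ha : MemCSL α a) {φ : ℝ}
    (hφ : Real.sin φ = 0) :
    iteratedDeriv 2 (g a) φ = ((2 * Real.cos φ : ℝ) : ℂ) *
      symbol (natCoeff a) ((2 * Real.cos φ : ℝ) : ℂ) (Circle.exp φ) := by
  have hc := continuous_symbol (ha.summable_natCoeff hα)
  have h1 : HasDerivAt (fun σ : ℝ => ((2 * Real.sin σ : ℝ) : ℂ)) ((2 * Real.cos φ : ℝ) : ℂ) φ :=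
    ((Real.hasDerivAt_sin φ).const_mul 2).ofReal_comp
  have h2 := hasDerivAt_mul_of_eq_zero h1 (by simp [hφ])
    (hc.comp (continuous_id.prodMk continuous_id)).continuousAt (k := fun σ : ℝ =>
      symbol (natCoeff a) ((2 * Real.cos σ : ℝ) : ℂ) (Circle.exp σ))
  rw [iteratedDeriv_succ, iteratedDeriv_one,
    show deriv (g a) = _ from funext fun σ => (ha.hasDerivAt_g hα σ).deriv]
  exact h2.deriv

/-- A zero forces `g φ = g ψ`, hence `φ = ψ` by injectivity. On the diagonal the symbol is a factor
of `g'`, and of `g''` at `0` and `π`, so each nondegeneracy condition excludes one case. -/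
theorem MemCSL.symbol_ne_zero (hα : 2 ≤ α) (ha : MemCSL α a) {φ ψ : ℝ}
    (hφ : φ ∈ Set.Icc 0 Real.pi) (hψ : ψ ∈ Set.Icc 0 Real.pi) :
    symbol (natCoeff a) ((2 * Real.cos φ : ℝ) : ℂ) (Circle.exp ψ) ≠ 0 := by
  intro h
  have h1 := ha.g_sub_g hα φ ψ
  rw [h, mul_zero, sub_eq_zero] at h1
  obtain rfl := ha.simple_arc hφ hψ h1
  rcases hφ.1.eq_or_lt with h2 | h2
  · subst h2
    refine ha.deriv2_zero_ne ?_
    rw [ha.iteratedDeriv_two_g hα Real.sin_zero, h, mul_zero]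
  rcases hφ.2.eq_or_lt with h3 | h3
  · subst h3
    refine ha.deriv2_pi_ne ?_
    rw [ha.iteratedDeriv_two_g hα Real.sin_pi, h, mul_zero]
  · refine ha.deriv_ne φ ⟨h2, h3⟩ ?_
    rw [(ha.hasDerivAt_g hα φ).deriv, h, mul_zero]

end Symbol

theorem haarAddCircle_singleton {T : ℝ} [hT : Fact (0 < T)] (x : AddCircle T) :
    haarAddCircle ({x} : Set (AddCircle T)) = 0 := by
  have h := AddCircle.volume_closedBall T (x := x) 0
  rw [Metric.closedBall_zero, mul_zero, min_eq_right hT.out.le, ENNReal.ofReal_zero,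
    volume_eq_smul_haarAddCircle, Measure.smul_apply, smul_eq_mul, mul_eq_zero] at h
  exact h.resolve_left (by simpa using hT.out)

/-! ### Identification of `b̂_n` with the divided difference -/

section HatSymbol

variable {α c C : ℝ} {a : Circle → ℂ} {n : ℕ}

variable (a) in
/-- The continuous function that agrees with `hatB a n s` outside of the removable
singularities. -/
def hatSymbol (n : ℕ) (s : ℂ) : C(AddCircle (2 * Real.pi), ℂ) :=
  symbolN (natCoeff a) n (tau _) (exp (I * s))

theorem hatSymbol_mem (n : ℕ) (s : ℂ) : hatSymbol a n s ∈ evenSubalgebra (2 * Real.pi) :=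
  symbolN_mem tau_mem_evenSubalgebra _ _ _

theorem hatSymbol_apply (n : ℕ) (s : ℂ) (x : AddCircle (2 * Real.pi)) :
    hatSymbol a n s x =
      symbolN (natCoeff a) n ((toCircle x : ℂ) + (toCircle x : ℂ)⁻¹) (exp (I * s)) := by
  rw [← tau_apply]
  exact map_symbolN (ContinuousMap.evalAlgHom ℂ ℂ x) (natCoeff a) n (tau _) (exp (I * s))

theorem MemCSL.hatB_eq (ha : MemCSL α a) (hn : 1 ≤ n) (s : ℂ) {x : AddCircle (2 * Real.pi)}
    (h1 : (toCircle x : ℂ) ≠ exp (I * s)) (h2 : (toCircle x : ℂ)⁻¹ ≠ exp (I * s)) :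
    hatB a n s (toCircle x) = hatSymbol a n s x := by
  rw [hatSymbol_apply, hatB, gN, ha.aN_sub_aN hn (Circle.coe_ne_zero _) (exp_ne_zero _)]
  have h0 := exp_ne_zero (I * s)
  have h3 := Circle.coe_ne_zero (toCircle x)
  generalize exp (I * s) = w at *
  generalize (toCircle x : ℂ) = t at *
  rw [div_eq_iff (mul_ne_zero (sub_ne_zero.2 h1) (sub_ne_zero.2 h2))]
  have : (t - w) * (t⁻¹ - w) = (w + w⁻¹ - (t + t⁻¹)) * w := by
    field_simp
    ring
  rw [this]
  ring

/-- The two functions can differ only where `t` is `e^{is}` or its inverse, a null set for the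
Fourier integral. -/
theorem MemCSL.toeplitz_hatB (ha : MemCSL α a) (hn : 1 ≤ n) (s : ℂ) (N : ℕ) :
    toeplitz N (hatB a n s) = toeplitzMat N (hatSymbol a n s) := by
  ext i j
  rw [toeplitz, toeplitzMat, Matrix.of_apply, Matrix.of_apply, coeff_eq_fourierCoeff]
  refine congrFun (fourierCoeff_congr_ae ?_) _
  have hinj : Function.Injective fun x : AddCircle (2 * Real.pi) => (toCircle x : ℂ) :=
    Subtype.val_injective.comp (injective_toCircle Real.two_pi_pos.ne')
  have hfin : ((fun x : AddCircle (2 * Real.pi) => (toCircle x : ℂ)) ⁻¹'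
      {exp (I * s), (exp (I * s))⁻¹}).Finite :=
    (Set.toFinite _).preimage hinj.injOn
  have hm : haarAddCircle ((fun x : AddCircle (2 * Real.pi) => (toCircle x : ℂ)) ⁻¹'
      {exp (I * s), (exp (I * s))⁻¹}) = 0 :=
    haveI : NullSingletonClass (haarAddCircle (T := 2 * Real.pi)) := ⟨haarAddCircle_singleton⟩
    hfin.measure_zero _
  filter_upwards [compl_mem_ae_iff.2 hm] with x hx
  simp only [Set.mem_compl_iff, Set.mem_preimage, Set.mem_insert_iff, Set.mem_singleton_iff,
    not_or] at hx
  exact ha.hatB_eq hn s hx.1 fun h => hx.2 (by rw [← h, inv_inv])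

/-- Inverting `t` preserves `a_n` and swaps the two factors of the denominator. -/
theorem MemCSL.tildeB_eq (ha : MemCSL α a) (hn : 1 ≤ n) (s : ℂ) :
    tildeB a n s = hatB a n s := by
  ext t
  have h : aN a n ((t⁻¹ : Circle) : ℂ) = aN a n (t : ℂ) := by
    rw [ha.aN_eq hn, ha.aN_eq hn, Circle.coe_inv]
    simp only [inv_inv, add_comm]
  rw [tildeB, hatB, hatB, h, Circle.coe_inv, inv_inv, mul_comm ((t : ℂ)⁻¹ - _)]

end HatSymbol

/-! ### Compactness: injectivity and uniform bounds on the rectangles -/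

section Rectangle

variable {α c C : ℝ} {a : Circle → ℂ}

theorem norm_exp_le_of_mem_PiN {n : ℕ} {s : ℂ} (hs : s ∈ PiN c C n) :
    ‖exp (I * s)‖ ≤ Real.exp (C / n) ∧ ‖(exp (I * s))⁻¹‖ ≤ Real.exp (C / n) := by
  rw [← Complex.exp_neg, norm_exp, norm_exp, Real.exp_le_exp, Real.exp_le_exp]
  simp only [mul_re, I_re, I_im, neg_re, zero_mul, one_mul, zero_sub, neg_neg]
  exact ⟨by linarith [hs.2.1], hs.2.2⟩

theorem re_mem_Ioo_of_mem_PiN (hc : 0 < c) {n : ℕ} (hn : 0 < n) {s : ℂ} (hs : s ∈ PiN c C n) :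
    s.re ∈ Set.Ioo 0 Real.pi := by
  have : 0 < c / n := by positivity
  exact ⟨this.trans_le hs.1.1, by linarith [hs.1.2]⟩

theorem exp_I_mul_ofReal (φ : ℝ) : exp (I * φ) = Circle.exp φ := by
  rw [Circle.coe_exp, mul_comm]

theorem exists_tendsto_of_mem_PiN (hc : 0 < c) {n : ℕ → ℕ} {s : ℕ → ℂ} (hn : ∀ k, k < n k)
    (hs : ∀ k, s k ∈ PiN c C (n k)) :
    ∃ φ ∈ Set.Icc 0 Real.pi, ∃ θ : ℕ → ℕ, StrictMono θ ∧
      Filter.Tendsto (fun k => s (θ k)) Filter.atTop (nhds ((φ : ℝ) : ℂ)) := by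
  obtain ⟨φ, hφ, θ, hθ, h⟩ := isCompact_Icc.tendsto_subseq (x := fun k => (s k).re)
    (s := Set.Icc 0 Real.pi) fun k =>
      Set.Ioo_subset_Icc_self (re_mem_Ioo_of_mem_PiN hc (by have := hn k; omega) (hs k))
  refine ⟨φ, hφ, θ, hθ, ?_⟩
  have hn' : Filter.Tendsto (fun k => n (θ k)) Filter.atTop Filter.atTop :=
    Filter.tendsto_atTop_mono (fun k => (hθ.id_le k).trans (hn (θ k)).le) Filter.tendsto_id
  have hC : Filter.Tendsto (fun k => C / (n (θ k) : ℝ)) Filter.atTop (nhds 0) :=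
    tendsto_const_nhds.div_atTop (tendsto_natCast_atTop_atTop.comp hn')
  have him : Filter.Tendsto (fun k => (s (θ k)).im) Filter.atTop (nhds 0) :=
    tendsto_of_tendsto_of_tendsto_of_le_of_le (by simpa using hC.neg) hC
      (fun k => (hs (θ k)).2.1) (fun k => (hs (θ k)).2.2)
  have h1 := ((continuous_ofReal.tendsto _).comp h).add
    (((continuous_ofReal.tendsto _).comp him).mul_const I)
  simpa [Function.comp_def, re_add_im] using h1

theorem exists_int_of_exp_I_mul_eq_one {z : ℂ} (hz : exp (I * z) = 1) :
    ∃ k : ℤ, z = ((2 * Real.pi * k : ℝ) : ℂ) := by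
  obtain ⟨k, hk⟩ := exp_eq_one_iff.1 hz
  refine ⟨k, mul_left_cancel₀ I_ne_zero (hk.trans ?_)⟩
  push_cast
  ring

theorem exp_I_mul_ne_inv {s : ℂ} (hs : s.re ∈ Set.Ioo 0 Real.pi) :
    exp (I * s) ≠ (exp (I * s))⁻¹ := by
  intro h
  obtain ⟨k, hk⟩ := exists_int_of_exp_I_mul_eq_one (z := s + s) (by
    rw [mul_add, exp_add]
    nth_rewrite 1 [h]
    exact inv_mul_cancel₀ (exp_ne_zero _))
  have hk' := congrArg re hk
  rw [add_re, ofReal_re] at hk'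
  have h4 : (0 : ℝ) < k := by nlinarith [hs.1, hs.2, Real.pi_pos]
  have h5 : (k : ℝ) < 1 := by nlinarith [hs.1, hs.2, Real.pi_pos]
  have : (0 : ℤ) < k := by exact_mod_cast h4
  have : k < (1 : ℤ) := by exact_mod_cast h5
  omega

/-- Equality of `w + w⁻¹` and `v + v⁻¹` means `w = v` or `w v = 1`. The second would put `s + σ` in
`2πℤ`, but its real part lies strictly between `0` and `2π`. -/
theorem exp_add_inv_inj {s σ : ℂ} (hs : s.re ∈ Set.Ioo 0 Real.pi) (hσ : σ.re ∈ Set.Ioo 0 Real.pi)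
    (h : exp (I * s) + (exp (I * s))⁻¹ = exp (I * σ) + (exp (I * σ))⁻¹) : s = σ := by
  have h0 := exp_ne_zero (I * s)
  have h1 := exp_ne_zero (I * σ)
  have h2 : (exp (I * s) - exp (I * σ)) * (exp (I * s) * exp (I * σ) - 1) = 0 := by
    field_simp at h
    linear_combination h
  rcases mul_eq_zero.1 h2 with h3 | h3
  · obtain ⟨k, hk⟩ := exists_int_of_exp_I_mul_eq_one (z := s - σ) (by
      rw [mul_sub, exp_sub, sub_eq_zero.1 h3, div_self h1])
    have hk' := congrArg re hk
    rw [sub_re, ofReal_re] at hk'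
    have h4 : (-1 : ℝ) < k := by nlinarith [hs.1, hs.2, hσ.1, hσ.2, Real.pi_pos]
    have h5 : (k : ℝ) < 1 := by nlinarith [hs.1, hs.2, hσ.1, hσ.2, Real.pi_pos]
    have h6 : k = 0 := by
      have : (-1 : ℤ) < k := by exact_mod_cast h4
      have : k < (1 : ℤ) := by exact_mod_cast h5
      omega
    rw [h6] at hk
    simpa [sub_eq_zero] using hk
  · obtain ⟨k, hk⟩ := exists_int_of_exp_I_mul_eq_one (z := s + σ) (by rw [mul_add, exp_add, sub_eq_zero.1 h3])
    have hk' := congrArg re hk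
    rw [add_re, ofReal_re] at hk'
    have h4 : (0 : ℝ) < k := by nlinarith [hs.1, hs.2, hσ.1, hσ.2, Real.pi_pos]
    have h5 : (k : ℝ) < 1 := by nlinarith [hs.1, hs.2, hσ.1, hσ.2, Real.pi_pos]
    have : (0 : ℤ) < k := by exact_mod_cast h4
    have : k < (1 : ℤ) := by exact_mod_cast h5
    omega

theorem tendsto_exp_I_mul {s : ℕ → ℂ} {φ : ℝ}
    (h : Filter.Tendsto s Filter.atTop (nhds (φ : ℂ))) :
    Filter.Tendsto (fun k => exp (I * s k)) Filter.atTop (nhds (Circle.exp φ : ℂ)) := by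
  rw [← exp_I_mul_ofReal]
  exact (continuous_exp.tendsto _).comp (h.const_mul I)

theorem exp_div_pow {n : ℕ} (hn : 0 < n) : Real.exp (C / n) ^ n = Real.exp C := by
  rw [← Real.exp_nat_mul, mul_div_cancel₀ _ (by positivity)]

/-- If two distinct points have equal values, the factor `w + w⁻¹ - z - z⁻¹` is nonzero, so the
divided difference vanishes. Along a sequence of such pairs the limit symbol would acquire a zero.
-/
theorem MemCSL.exists_injOn_gN (hα : 2 ≤ α) (ha : MemCSL α a) (hc : 0 < c) (hC : 0 < C) :
    ∃ N₀ : ℕ, ∀ n : ℕ, N₀ < n → Set.InjOn (gN a n) (PiN c C n) := by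
  by_contra! h
  simp only [Set.InjOn, not_forall] at h
  choose n hn s hs σ hσ hg hne using h
  have hn0 : ∀ k, 0 < n k := fun k => by have := hn k; omega
  obtain ⟨φ, hφ, θ, hθ, h1⟩ := exists_tendsto_of_mem_PiN hc hn hs
  -- A second extraction, along the first subsequence, makes both points converge.
  obtain ⟨ψ, hψ, θ', hθ', h2⟩ := exists_tendsto_of_mem_PiN hc (n := fun k => n (θ k))
    (fun k => (hθ.id_le k).trans_lt (hn (θ k))) fun k => hσ (θ k)
  have h1' := tendsto_exp_I_mul (h1.comp hθ'.tendsto_atTop)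
  have h2' := tendsto_exp_I_mul h2
  have hθn : ∀ k, k < n (θ (θ' k)) := fun k =>
    ((hθ.comp hθ').id_le k).trans_lt (hn _)
  have h3 := tendsto_symbolN (𝓑 := ℂ) (ha.summable_natCoeff hα)
    (n := fun k => n (θ (θ' k)))
    (Filter.tendsto_atTop_mono (fun k => (hθn k).le) Filter.tendsto_id)
    (h1'.add (h1'.inv₀ (Circle.coe_ne_zero _))) h2' (Circle.coe_ne_zero _)
    (fun k => mul_inv_cancel₀ (exp_ne_zero _)) (q := fun k => Real.exp (C / n (θ (θ' k))))
    (K := Real.exp C) (fun k => Real.one_le_exp (by positivity))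
    (fun k => (exp_div_pow (hn0 _)).le) (fun k => (norm_exp_le_of_mem_PiN (hs _)).1)
    (fun k => (norm_exp_le_of_mem_PiN (hs _)).2) (fun k => (norm_exp_le_of_mem_PiN (hσ _)).1)
    (fun k => (norm_exp_le_of_mem_PiN (hσ _)).2)
  rw [exp_add_inv] at h3
  refine ha.symbol_ne_zero hα hφ hψ (tendsto_nhds_unique h3 (tendsto_const_nhds.congr fun k => ?_))
  have h4 := ha.aN_sub_aN (n := n (θ (θ' k))) (hn0 _) (exp_ne_zero (I * s (θ (θ' k))))
    (exp_ne_zero (I * σ (θ (θ' k))))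
  have h5 := hg (θ (θ' k))
  rw [gN, gN] at h5
  rw [h5, sub_self, eq_comm, mul_eq_zero] at h4
  refine (h4.resolve_left fun h6 => hne (θ (θ' k)) ?_).symm
  exact (exp_add_inv_inj (re_mem_Ioo_of_mem_PiN hc (hn0 _) (hσ _))
    (re_mem_Ioo_of_mem_PiN hc (hn0 _) (hs _)) (sub_eq_zero.1 h6)).symm

theorem MemCSL.symbol_mem_and_isUnit (hα : 2 ≤ α) (ha : MemCSL α a) {ψ : ℝ}
    (hψ : ψ ∈ Set.Icc 0 Real.pi) :
    symbol (natCoeff a) (tau (2 * Real.pi)) (Circle.exp ψ) ∈ evenSubalgebra (2 * Real.pi) ∧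
      IsUnit (symbol (natCoeff a) (tau (2 * Real.pi)) (Circle.exp ψ)) := by
  have hs := summable_smul_divDiff (ha.summable_natCoeff hα)
    (fourier_one_mul_fourier_neg_one (T := 2 * Real.pi)) (fourier_norm _).le (fourier_norm _).le
    (Circle.norm_coe (Circle.exp ψ))
  refine ⟨symbol_mem isClosed_evenSubalgebra tau_mem_evenSubalgebra hs,
    (ContinuousMap.isUnit_iff_forall_ne_zero _).2 fun x => ?_⟩
  have h1 := map_symbol (φ := ContinuousMap.evalAlgHom ℂ ℂ x) (continuous_eval_const x) hs
  -- The symbol depends on the point only through `t + t⁻¹`, so the angle can be chosen in `[0, π]`.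
  have h2 : tau (2 * Real.pi) x = ((2 * Real.cos (Real.arccos (toCircle x : ℂ).re) : ℝ) : ℂ) := by
    have h3 := abs_le.1 ((abs_re_le_norm (toCircle x : ℂ)).trans (Circle.norm_coe _).le)
    rw [Real.cos_arccos h3.1 h3.2, tau_apply, ← Circle.coe_inv, Circle.coe_inv_eq_conj, add_conj]
  have h4 : symbol (natCoeff a) (tau (2 * Real.pi)) (Circle.exp ψ) x =
      symbol (natCoeff a) (tau (2 * Real.pi) x) (Circle.exp ψ) := h1
  rw [h4, h2]
  exact ha.symbol_ne_zero hα ⟨Real.arccos_nonneg _, Real.arccos_le_pi _⟩ hψ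

theorem MemCSL.exists_norm_le (hα : 2 ≤ α) (ha : MemCSL α a) (hc : 0 < c) (hC : 0 < C) :
    ∃ (N₀ : ℕ) (M : ℝ), 0 ≤ M ∧ ∀ n : ℕ, N₀ < n → ∀ s ∈ PiN c C n, ∀ x : Fin (n + 2) → ℂ,
      ‖WithLp.toLp 2 x‖ ≤
        M * ‖WithLp.toLp 2 ((toeplitzMat (n + 2) (hatSymbol a n s)).mulVec x)‖ := by
  by_contra! h
  -- The index `k` serves both as the threshold for `n` and as the constant to be violated.
  choose n hn s hs x hx using fun k : ℕ => h k k (Nat.cast_nonneg k)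
  have hn0 : ∀ k, 0 < n k := fun k => by have := hn k; omega
  obtain ⟨φ, hφ, θ, hθ, h1⟩ := exists_tendsto_of_mem_PiN hc hn hs
  have hθn : ∀ k, k < n (θ k) := fun k => (hθ.id_le k).trans_lt (hn _)
  obtain ⟨hmem, hunit⟩ := ha.symbol_mem_and_isUnit hα hφ
  obtain ⟨N₀, K, hK, hev⟩ := eventually_norm_le_toeplitzMat hmem hunit
  have h3 := tendsto_symbolN (𝓑 := C(AddCircle (2 * Real.pi), ℂ)) (ha.summable_natCoeff hα)
    (n := fun k => n (θ k))
    (Filter.tendsto_atTop_mono (fun k => (hθn k).le) Filter.tendsto_id)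
    (t := fun _ => fourier 1) (u := fun _ => fourier (-1)) tendsto_const_nhds
    (tendsto_exp_I_mul h1) (Circle.coe_ne_zero _)
    (fun _ => fourier_one_mul_fourier_neg_one) (q := fun k => Real.exp (C / n (θ k)))
    (K := Real.exp C) (fun k => Real.one_le_exp (by positivity))
    (fun k => (exp_div_pow (hn0 _)).le)
    (fun k => (fourier_norm _).le.trans (Real.one_le_exp (by positivity)))
    (fun k => (fourier_norm _).le.trans (Real.one_le_exp (by positivity)))
    (fun k => (norm_exp_le_of_mem_PiN (hs _)).1) (fun k => (norm_exp_le_of_mem_PiN (hs _)).2)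
  obtain ⟨k, hk, hk1, hk2⟩ := ((h3.eventually hev).and
    ((Filter.eventually_ge_atTop N₀).and (Filter.eventually_ge_atTop ⌈K⌉₊))).exists
  have h4 := hk (n (θ k) + 2) (by have := hθn k; omega) (x (θ k))
  refine (hx (θ k)).not_ge (h4.trans ?_)
  refine mul_le_mul_of_nonneg_right ?_ (norm_nonneg _)
  calc K ≤ ⌈K⌉₊ := Nat.le_ceil K
    _ ≤ (θ k : ℝ) := by exact_mod_cast hk2.trans (hθ.id_le k)

end Rectangle

/-! ### Fourier coefficients as linear functionals -/

section Coefficients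

variable {T : ℝ} [hT : Fact (0 < T)]

theorem fourierCoeff_eq_inner (b : C(AddCircle T, ℂ)) (k : ℤ) :
    fourierCoeff b k = inner ℂ (fourierLp (T := T) 2 k) (mulOp b (fourierLp 2 0)) := by
  rw [inner_fourierLp_mulOp, sub_zero]

variable (T) in
/-- The Fourier coefficient as a linear functional. -/
def coeffHom (k : ℤ) : C(AddCircle T, ℂ) →ₗ[ℂ] ℂ where
  toFun b := fourierCoeff b k
  map_add' b c := by
    rw [fourierCoeff_eq_inner, fourierCoeff_eq_inner, fourierCoeff_eq_inner, map_add, add_apply,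
      inner_add_right]
  map_smul' r b := by
    rw [fourierCoeff_eq_inner, fourierCoeff_eq_inner, map_smul, smul_apply, inner_smul_right]
    rfl

theorem coeffHom_apply (b : C(AddCircle T, ℂ)) (k : ℤ) : coeffHom T k b = fourierCoeff b k := rfl

theorem coeffHom_fourier_mul (b : C(AddCircle T, ℂ)) (m k : ℤ) :
    coeffHom T k (fourier m * b) = fourierCoeff b (k - m) := by
  rw [coeffHom_apply, fourierCoeff_eq_inner, mul_comm, mulOp_mul, mul_apply_eq_comp,
    mulOp_fourier_fourierLp, zero_add, inner_fourierLp_mulOp]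

theorem coeffHom_fourier (m k : ℤ) :
    coeffHom T k (fourier m) = if k = m then 1 else 0 := by
  rw [coeffHom_apply, fourierCoeff_eq_inner, mulOp_fourier_fourierLp, zero_add,
    orthonormal_iff_ite.1 orthonormal_fourier]

end Coefficients

theorem fourier_pow {T : ℝ} (m : ℤ) (j : ℕ) : (fourier m : C(AddCircle T, ℂ)) ^ j = fourier (j * m) := by
  ext x
  rw [ContinuousMap.pow_apply, fourier_apply, fourier_apply, mul_smul, natCast_zsmul,
    toCircle_nsmul, Circle.coe_pow]

/-! ### Coefficient form of the factorization -/

section Recurrence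

variable {α : ℝ} {a : Circle → ℂ} {n : ℕ}

/-- The Fourier coefficients of `a_n - λ = (w + w⁻¹ - t - t⁻¹) b`. -/
theorem MemCSL.coeff_sub_gN (ha : MemCSL α a) (hn : 1 ≤ n) (s : ℂ) {k : ℤ} (hk : k.natAbs < n) :
    coeff a k - (if k = 0 then gN a n s else 0) =
      (exp (I * s) + (exp (I * s))⁻¹) * fourierCoeff (hatSymbol a n s) k -
        fourierCoeff (hatSymbol a n s) (k - 1) - fourierCoeff (hatSymbol a n s) (k + 1) := by
  have h := sub_mul_symbolN (fourier_one_mul_fourier_neg_one (T := 2 * Real.pi))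
    (exp_ne_zero (I * s)) (natCoeff a) n
  rw [show symbolN (natCoeff a) n (fourier 1 + fourier (-1)) (exp (I * s)) = hatSymbol a n s
    from rfl] at h
  have h1 := congrArg (coeffHom (2 * Real.pi) k) h
  rw [sub_mul, add_mul (fourier 1), map_sub, map_add (coeffHom _ _), coeffHom_fourier_mul, coeffHom_fourier_mul,
    ← Algebra.smul_def, map_smul, coeffHom_apply, smul_eq_mul, map_sub, map_sum,
    Algebra.algebraMap_eq_smul_one, map_smul] at h1
  have h2 : (1 : C(AddCircle (2 * Real.pi), ℂ)) = fourier 0 := by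
    ext x; rw [fourier_zero]; rfl
  rw [sub_neg_eq_add] at h1
  rw [sub_sub, h1, h2, coeffHom_fourier, gN, ha.aN_eq hn]
  have h3 : ∀ j ∈ Finset.range n, coeffHom (2 * Real.pi) k
      (natCoeff a j • (fourier 1 ^ j + fourier (-1) ^ j)) =
      natCoeff a j * ((if k = (j : ℤ) then 1 else 0) + (if -k = (j : ℤ) then 1 else 0)) := by
    intro j _
    rw [map_smul, map_add, fourier_pow, fourier_pow, coeffHom_fourier, coeffHom_fourier, mul_one,
      mul_neg_one, smul_eq_mul]
    simp only [neg_eq_iff_eq_neg]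
  rw [Finset.sum_congr rfl h3]
  simp only [mul_add, Finset.sum_add_distrib, mul_ite, mul_one, mul_zero, smul_eq_mul]
  have h4 : ∀ m : ℤ, m.natAbs < n → ∑ j ∈ Finset.range n, (if m = (j : ℤ) then natCoeff a j else 0) =
      if 0 ≤ m then coeff a m else 0 := by
    intro m hm
    by_cases h0 : 0 ≤ m
    · lift m to ℕ using h0
      simp only [Nat.cast_inj, Finset.sum_ite_eq, Finset.mem_range]
      rw [if_pos (by simpa using hm), if_pos (by positivity), natCoeff]
    · rw [if_neg h0]
      refine Finset.sum_eq_zero fun j _ => if_neg (by omega)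
  rw [h4 k hk, h4 (-k) (by simpa using hk), ha.coeff_neg]
  -- For `k = 0` both sums contribute, and the surplus cancels the term subtracted in
  -- `MemCSL.aN_eq`; otherwise exactly one contributes.
  rcases lt_trichotomy k 0 with h5 | rfl | h5
  · rw [if_neg h5.ne, if_neg h5.ne, if_neg h5.not_ge, if_pos (by omega)]
    ring
  · simp only [natCoeff, Nat.cast_zero, le_refl, neg_zero, if_true]
    ring
  · rw [if_neg h5.ne', if_neg h5.ne', if_pos h5.le, if_neg (by omega)]
    ring

end Recurrence

/-! ### Multiples of the quadratic with roots `w` and `w⁻¹` -/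

section Polynomials

open Polynomial

theorem exists_polynomial_coeff {N : ℕ} (x : Fin N → ℂ) :
    ∃ P : ℂ[X], P.degree < N ∧ ∀ k : Fin N, P.coeff k = x k := by
  refine ⟨((degreeLTEquiv ℂ N).symm x : ℂ[X]), mem_degreeLT.1 (Subtype.prop _), fun k => ?_⟩
  exact congrFun ((degreeLTEquiv ℂ N).apply_symm_apply x) k

theorem degree_quadratic (ρ : ℂ) : (X ^ 2 - C ρ * X + 1 : ℂ[X]).degree = 2 := by
  compute_degree!

theorem degree_quadratic_mul_lt_iff (ρ : ℂ) {n : ℕ} {R : ℂ[X]} :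
    ((X ^ 2 - C ρ * X + 1) * R).degree < ((n + 2 : ℕ) : WithBot ℕ) ↔ R.degree < n := by
  rcases eq_or_ne R 0 with rfl | h0
  · simp only [mul_zero, degree_zero, WithBot.bot_lt_natCast]
  · rw [degree_mul, degree_quadratic, degree_eq_natDegree h0]
    norm_cast
    omega

/-- The transpose of multiplication by the quadratic acts on the weights `γ`. Both sides are linear
in `R`, so monomials suffice. -/
theorem sum_coeff_quadratic_mul (γ : ℕ → ℂ) (ρ : ℂ) {n : ℕ} {R : ℂ[X]} (hR : R.degree < n) :
    ∑ j : Fin (n + 2), γ j * ((X ^ 2 - C ρ * X + 1) * R).coeff j =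
      ∑ j : Fin n, (γ (j + 2) - ρ * γ (j + 1) + γ j) * R.coeff j := by
  rw [sum_fin (fun j c => γ j * c) (by simp) ((degree_quadratic_mul_lt_iff ρ).2 hR),
    sum_fin (fun j c => (γ (j + 2) - ρ * γ (j + 1) + γ j) * c) (by simp) hR]
  let L : (ℕ → ℂ) → ℂ[X] →ₗ[ℂ] ℂ := fun γ => lsum fun j => γ j • LinearMap.id
  have hL : ∀ γ P, L γ P = P.sum fun j c => γ j * c := fun _ _ => rfl
  have hm : ∀ γ m c, L γ (monomial m c) = γ m * c := fun γ m c => by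
    rw [hL, sum_monomial_index _ _ (by simp)]
  rw [← hL, ← hL (fun j => γ (j + 2) - ρ * γ (j + 1) + γ j)]
  clear hR
  induction R using Polynomial.induction_on' with
  | add p q hp hq => rw [mul_add, map_add, map_add, hp, hq]
  | monomial m c =>
    have : (X ^ 2 - C ρ * X + 1) * monomial m c =
        monomial (m + 2) c - monomial (m + 1) (ρ * c) + monomial m c := by
      simp only [← C_mul_X_pow_eq_monomial, C_mul]
      ring
    rw [this, map_add, map_sub, hm, hm, hm, hm]
    ring

theorem sum_coeff_mul_pow {N : ℕ} {P : ℂ[X]} (hP : P.degree < N) (z : ℂ) :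
    ∑ k : Fin N, P.coeff k * z ^ (k : ℕ) = P.eval z := by
  rw [sum_fin (fun j c => c * z ^ j) (by simp) hP, eval_eq_sum]

theorem eq_zero_of_coeff_fin {N : ℕ} {P : ℂ[X]} (hP : P.degree < N)
    (h : ∀ k : Fin N, P.coeff k = 0) : P = 0 := by
  ext k
  rcases lt_or_ge k N with hk | hk
  · exact h ⟨k, hk⟩
  · exact coeff_eq_zero_of_degree_lt (hP.trans_le (by exact_mod_cast hk))

theorem quadratic_eq {w : ℂ} (hw : w ≠ 0) :
    (X ^ 2 - C (w + w⁻¹) * X + 1 : ℂ[X]) = (X - C w) * (X - C w⁻¹) := by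
  have : (C w * C w⁻¹ : ℂ[X]) = 1 := by rw [← C_mul, mul_inv_cancel₀ hw, C_1]
  rw [C_add]
  linear_combination -this

theorem exists_eq_quadratic_mul {w : ℂ} (hw : w ≠ 0) (hne : w ≠ w⁻¹) {P : ℂ[X]}
    (h1 : P.eval w = 0) (h2 : P.eval w⁻¹ = 0) :
    ∃ R, P = (X ^ 2 - C (w + w⁻¹) * X + 1) * R := by
  obtain ⟨S, rfl⟩ := dvd_iff_isRoot.2 h1
  rw [eval_mul, eval_sub, eval_X, eval_C, mul_eq_zero, sub_eq_zero] at h2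
  obtain ⟨R, rfl⟩ := dvd_iff_isRoot.2 (h2.resolve_left hne.symm)
  exact ⟨R, by rw [quadratic_eq hw, mul_assoc]⟩

end Polynomials

/-! ### The eigenvalue criterion -/

section Eigenvalues

open Polynomial

variable {α : ℝ} {a : Circle → ℂ} {n : ℕ}

/-- The quadratic is `z (z + z⁻¹ - w - w⁻¹)`, so its product with `b̂_n` is `-z (a_n - λ)`. The
factor `z` shifts row `i` to `i + 1`; the truncation is invisible because `|i - j| < n`. -/
theorem MemCSL.toeplitzMat_mulVec_quadratic (ha : MemCSL α a) (hn : 1 ≤ n) (s : ℂ) {R : ℂ[X]}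
    (hR : R.degree < n) (i : Fin n) :
    (toeplitzMat (n + 2) (hatSymbol a n s)).mulVec (fun k : Fin (n + 2) =>
      ((X ^ 2 - C (exp (I * s) + (exp (I * s))⁻¹) * X + 1) * R).coeff k) i.castSucc.succ =
      gN a n s * R.coeff i - (toeplitz n a).mulVec (fun k : Fin n => R.coeff k) i := by
  have h := sum_coeff_quadratic_mul (fun j => fourierCoeff (hatSymbol a n s) ((i : ℤ) + 1 - j))
    (exp (I * s) + (exp (I * s))⁻¹) hR
  have h1 : ∀ j : Fin n, fourierCoeff (hatSymbol a n s) ((i : ℤ) + 1 - ((j : ℕ) + 2 : ℕ)) -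
      (exp (I * s) + (exp (I * s))⁻¹) *
        fourierCoeff (hatSymbol a n s) ((i : ℤ) + 1 - ((j : ℕ) + 1 : ℕ)) +
      fourierCoeff (hatSymbol a n s) ((i : ℤ) + 1 - (j : ℕ)) =
      (if i = j then gN a n s else 0) - coeff a ((i : ℤ) - (j : ℤ)) := fun j => by
    have h2 := ha.coeff_sub_gN hn s (k := (i : ℤ) - (j : ℤ)) (by omega)
    have h3 : ((i : ℤ) - (j : ℤ) = 0) ↔ i = j := by rw [Fin.ext_iff]; omega
    simp only [h3] at h2
    rw [show (i : ℤ) + 1 - ((j : ℕ) + 2 : ℕ) = (i : ℤ) - j - 1 by push_cast; ring,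
      show (i : ℤ) + 1 - ((j : ℕ) + 1 : ℕ) = (i : ℤ) - j by push_cast; ring,
      show (i : ℤ) + 1 - (j : ℕ) = (i : ℤ) - j + 1 by ring]
    linear_combination h2
  simp only [h1, sub_mul, Finset.sum_sub_distrib, ite_mul, zero_mul, Finset.sum_ite_eq,
    Finset.mem_univ, if_true] at h
  simp only [Matrix.mulVec, dotProduct, toeplitzMat, toeplitz, Matrix.of_apply, Fin.val_succ,
    Fin.val_castSucc, Nat.cast_add, Nat.cast_one]
  exact h

theorem hasEigenvalue_toLin'_iff {A : Matrix (Fin n) (Fin n) ℂ} {μ : ℂ} :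
    Module.End.HasEigenvalue (Matrix.toLin' A) μ ↔ ∃ x, x ≠ 0 ∧ A.mulVec x = μ • x := by
  constructor
  · intro h
    obtain ⟨x, hx⟩ := h.exists_hasEigenvector
    exact ⟨x, hx.2, hx.apply_eq_smul⟩
  · rintro ⟨x, h0, hx⟩
    exact Module.End.hasEigenvalue_of_hasEigenvector
      ⟨Module.End.mem_eigenspace_iff.2 (by rwa [Matrix.toLin'_apply]), h0⟩

theorem sum_comp_rev_mul_pow (u : Fin (n + 2) → ℂ) {z : ℂ} (hz : z ≠ 0) :
    ∑ k : Fin (n + 2), u (Fin.rev k) * z ^ (k : ℕ) =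
      z ^ (n + 1) * ∑ k : Fin (n + 2), u k * z⁻¹ ^ (k : ℕ) := by
  rw [← Equiv.sum_comp Fin.revPerm, Finset.mul_sum]
  refine Finset.sum_congr rfl fun k _ => ?_
  rw [Fin.revPerm_apply, Fin.rev_rev, Fin.val_rev, mul_left_comm, inv_pow,
    show n + 2 - ((k : ℕ) + 1) = n + 1 - k by omega, pow_sub₀ z hz (by omega)]

theorem eq_single_add_single {y : Fin (n + 2) → ℂ} (h : ∀ i : Fin n, y i.castSucc.succ = 0) :
    y = y 0 • Pi.single 0 1 + y (Fin.last _) • Pi.single (Fin.last _) 1 := by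
  ext k
  induction k using Fin.cases with
  | zero => simp
  | succ k =>
    induction k using Fin.lastCases with
    | last => simp [Fin.succ_last]
    | cast i =>
      rw [h i]
      have : i.castSucc.succ ≠ Fin.last (n + 1) := by
        rw [← Fin.succ_last, Ne, Fin.succ_inj]; exact (Fin.castSucc_lt_last i).ne
      simp [this]

/-- The middle rows vanish exactly when the vector lies in the span of `u` and its reversal.
Divisibility by the quadratic amounts to vanishing at `w` and `w⁻¹`, which are distinct by `hs`: two
linear equations in two unknowns. -/
theorem MemCSL.hasEigenvalue_iff (ha : MemCSL α a) (hn : 1 ≤ n) {s : ℂ}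
    (hs : exp (I * s) ≠ (exp (I * s))⁻¹)
    (hT : IsUnit (toeplitzMat (n + 2) (hatSymbol a n s))) {θ : ℂ → ℂ}
    (hθ : ∀ z, θ z = ∑ k : Fin (n + 2),
      ((toeplitzMat (n + 2) (hatSymbol a n s))⁻¹.mulVec (Pi.single 0 1)) k * z ^ (k : ℕ)) :
    Module.End.HasEigenvalue (Matrix.toLin' (toeplitz n a)) (gN a n s) ↔
      θ (exp (I * s)) * ((exp (I * s))⁻¹ ^ (n + 1) * θ (exp (I * s))) -
        exp (I * s) ^ (n + 1) * θ (exp (I * s))⁻¹ * θ (exp (I * s))⁻¹ = 0 := by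
  have hw := exp_ne_zero (I * s)
  have hrow := fun {R : ℂ[X]} (hR : R.degree < n) => ha.toeplitzMat_mulVec_quadratic hn s hR
  set A := toeplitzMat (n + 2) (hatSymbol a n s) with hA
  set u := A⁻¹.mulVec (Pi.single 0 1) with hu
  generalize exp (I * s) = w at *
  have hAu : A.mulVec u = Pi.single 0 1 := by
    rw [hu, Matrix.mulVec_mulVec, Matrix.mul_nonsing_inv _ ((Matrix.isUnit_iff_isUnit_det A).1 hT),
      Matrix.one_mulVec]
  -- By evenness of the symbol, the last column of the inverse is the reversed first column.
  have hAv : A.mulVec (u ∘ Fin.rev) = Pi.single (Fin.last _) 1 := by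
    rw [hA, toeplitzMat_mulVec_rev (apply_neg_of_mem_evenSubalgebra (hatSymbol_mem n s)), ← hA, hAu]
    ext k
    rw [Function.comp_apply, Pi.single_apply, Pi.single_apply]
    simp only [Fin.rev_eq_iff, Fin.rev_zero]
  have hinj := Matrix.mulVec_injective_iff_isUnit.2 hT
  have heval : ∀ (p q : ℂ) {z : ℂ}, z ≠ 0 →
      ∑ k : Fin (n + 2), (p • u + q • (u ∘ Fin.rev)) k * z ^ (k : ℕ) =
        θ z * p + z ^ (n + 1) * θ z⁻¹ * q := fun p q z hz => by
    rw [hθ, hθ, ← sum_comp_rev_mul_pow u hz, Finset.sum_mul, Finset.sum_mul,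
      ← Finset.sum_add_distrib]
    refine Finset.sum_congr rfl fun k _ => ?_
    simp only [Pi.add_apply, Pi.smul_apply, smul_eq_mul, Function.comp_apply]
    ring
  -- The rows are the values at `w` and at `w⁻¹`; the columns belong to `u` and to its reversal.
  have hdet : (∃ v : Fin 2 → ℂ, v ≠ 0 ∧
      (!![θ w, w ^ (n + 1) * θ w⁻¹; θ w⁻¹, w⁻¹ ^ (n + 1) * θ w]).mulVec v = 0) ↔
      θ w * (w⁻¹ ^ (n + 1) * θ w) - w ^ (n + 1) * θ w⁻¹ * θ w⁻¹ = 0 := by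
    rw [Matrix.exists_mulVec_eq_zero_iff, Matrix.det_fin_two_of]
  rw [hasEigenvalue_toLin'_iff, ← hdet]
  constructor
  · rintro ⟨x, hx0, hx⟩
    obtain ⟨R, hR, hRx⟩ := exists_polynomial_coeff x
    obtain rfl : (fun k : Fin n => R.coeff k) = x := funext hRx
    have hP := (degree_quadratic_mul_lt_iff (w + w⁻¹)).2 hR
    set P := (X ^ 2 - C (w + w⁻¹) * X + 1) * R with hPdef
    set y : Fin (n + 2) → ℂ := fun k => P.coeff k with hy
    have hmid : ∀ i : Fin n, A.mulVec y i.castSucc.succ = 0 := fun i => by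
      rw [hrow hR i, hx, Pi.smul_apply, smul_eq_mul, sub_self]
    have hAy := eq_single_add_single hmid
    set p := A.mulVec y 0
    set q := A.mulVec y (Fin.last _)
    have hyu : y = p • u + q • (u ∘ Fin.rev) := hinj <| by
      change A.mulVec y = A.mulVec _
      rw [hAy, Matrix.mulVec_add, Matrix.mulVec_smul, Matrix.mulVec_smul, hAu, hAv]
    have hz : ∀ z : ℂ, z ≠ 0 → θ z * p + z ^ (n + 1) * θ z⁻¹ * q = P.eval z := fun z hz => by
      rw [← heval p q hz, ← hyu]
      exact sum_coeff_mul_pow hP z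
    refine ⟨![p, q], fun h0 => hx0 ?_, ?_⟩
    · have hp : p = 0 := congrFun h0 0
      have hq : q = 0 := congrFun h0 1
      have hP0 : P = 0 := eq_zero_of_coeff_fin hP fun k => by
        have := congrFun hyu k
        rw [hp, hq] at this
        simpa using this
      rw [hPdef, quadratic_eq hw] at hP0
      have hR0 : R = 0 := by
        simpa [X_sub_C_ne_zero] using hP0
      ext k
      simp [hR0]
    · have e1 := hz w hw
      have e2 := hz w⁻¹ (inv_ne_zero hw)
      rw [inv_inv] at e2
      rw [hPdef, quadratic_eq hw] at e1 e2
      simp only [eval_mul, eval_sub, eval_X, eval_C, sub_self, zero_mul, mul_zero] at e1 e2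
      ext i
      fin_cases i
      · simpa [Matrix.mulVec, dotProduct, Fin.sum_univ_two] using e1
      · simpa [Matrix.mulVec, dotProduct, Fin.sum_univ_two] using e2
  · rintro ⟨v, hv0, hv⟩
    have e1 := congrFun hv 0
    have e2 := congrFun hv 1
    simp only [Matrix.mulVec, dotProduct, Fin.sum_univ_two, Matrix.of_apply, Matrix.cons_val_zero,
      Matrix.cons_val_one, Pi.zero_apply] at e1 e2
    set y := v 0 • u + v 1 • (u ∘ Fin.rev) with hy
    have hAy : A.mulVec y = v 0 • Pi.single 0 1 + v 1 • Pi.single (Fin.last _) 1 := by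
      rw [hy, Matrix.mulVec_add, Matrix.mulVec_smul, Matrix.mulVec_smul, hAu, hAv]
    obtain ⟨P, hP, hPy⟩ := exists_polynomial_coeff y
    have hPe : ∀ z : ℂ, z ≠ 0 → P.eval z = θ z * v 0 + z ^ (n + 1) * θ z⁻¹ * v 1 := fun z hz => by
      rw [← heval _ _ hz, ← sum_coeff_mul_pow hP]
      exact Finset.sum_congr rfl fun k _ => by rw [hPy]
    obtain ⟨R, rfl⟩ := exists_eq_quadratic_mul hw hs (P := P) (by rw [hPe w hw, e1])
      (by rw [hPe _ (inv_ne_zero hw), inv_inv, e2])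
    have hR := (degree_quadratic_mul_lt_iff (w + w⁻¹)).1 hP
    refine ⟨fun k => R.coeff k, fun h0 => hv0 ?_, ?_⟩
    · have hR0 : R = 0 := eq_zero_of_coeff_fin hR fun k => congrFun h0 k
      have hy0 : y = 0 := funext fun k => by rw [← hPy, hR0, mul_zero, coeff_zero]; rfl
      rw [hy0, Matrix.mulVec_zero] at hAy
      have f1 := congrFun hAy 0
      have f2 := congrFun hAy (Fin.last _)
      ext i
      fin_cases i
      · simpa [Fin.last] using f1.symm
      · simpa [Fin.last] using f2.symm
    · ext i
      have h1 := hrow hR i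
      have hfy : (fun k : Fin (n + 2) => ((X ^ 2 - C (w + w⁻¹) * X + 1) * R).coeff k) = y :=
        funext hPy
      rw [hfy, hAy] at h1
      have h2 : i.castSucc.succ ≠ Fin.last (n + 1) := by
        rw [← Fin.succ_last, Ne, Fin.succ_inj]; exact (Fin.castSucc_lt_last i).ne
      simp only [Pi.add_apply, Pi.smul_apply, Pi.single_eq_of_ne h2,
        Pi.single_eq_of_ne (Fin.succ_ne_zero _), smul_zero, add_zero] at h1
      exact (sub_eq_zero.1 h1.symm).symm

end Eigenvalues

end ToeplitzCSL

end

theorem mainTheorem4 (α : ℝ) (hα : 2 ≤ α) (a : Circle → ℂ) (ha : ToeplitzCSL.MemCSL α a)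
    (c C : ℝ) (hc : 0 < c) (hC : 0 < C) :
    ∃ (N₀ : ℕ) (M : ℝ), ∀ n : ℕ, N₀ < n →
      Set.InjOn (ToeplitzCSL.gN a n) (ToeplitzCSL.PiN c C n) ∧
      ∀ s ∈ ToeplitzCSL.PiN c C n,
        IsUnit (ToeplitzCSL.toeplitz (n + 2) (ToeplitzCSL.hatB a n s)) ∧
        ‖Matrix.toEuclideanCLM (𝕜 := ℂ)
          (ToeplitzCSL.toeplitz (n + 2) (ToeplitzCSL.hatB a n s))⁻¹‖ ≤ M ∧
        IsUnit (ToeplitzCSL.toeplitz (n + 2) (ToeplitzCSL.tildeB a n s)) ∧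
        ‖Matrix.toEuclideanCLM (𝕜 := ℂ)
          (ToeplitzCSL.toeplitz (n + 2) (ToeplitzCSL.tildeB a n s))⁻¹‖ ≤ M ∧
        (Module.End.HasEigenvalue (Matrix.toLin' (ToeplitzCSL.toeplitz n a))
            (ToeplitzCSL.gN a n s) ↔
          Complex.exp (-(Complex.I * (n + 1) * s)) *
              ToeplitzCSL.Theta a n s (Complex.exp (Complex.I * s)) *
              ToeplitzCSL.hatTheta a n s (Complex.exp (-(Complex.I * s))) -
            Complex.exp (Complex.I * (n + 1) * s) *
              ToeplitzCSL.Theta a n s (Complex.exp (-(Complex.I * s))) *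
              ToeplitzCSL.hatTheta a n s (Complex.exp (Complex.I * s)) = 0) := by
  obtain ⟨N₁, h₁⟩ := ha.exists_injOn_gN hα hc hC
  obtain ⟨N₂, M, hM, h₂⟩ := ha.exists_norm_le hα hc hC
  refine ⟨max N₁ N₂, M, fun n hn => ⟨h₁ n (by omega), fun s hs => ?_⟩⟩
  have hn1 : 1 ≤ n := by omega
  have hT := ToeplitzCSL.isUnit_and_norm_inv_le hM (h₂ n (by omega) s hs)
  have htilde := ha.tildeB_eq hn1 s
  have hhat := ha.toeplitz_hatB hn1 s (n + 2)
  rw [htilde, hhat]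
  refine ⟨hT.1, hT.2, hT.1, hT.2, ?_⟩
  have hw : Complex.exp (Complex.I * s) ≠ (Complex.exp (Complex.I * s))⁻¹ :=
    ToeplitzCSL.exp_I_mul_ne_inv (ToeplitzCSL.re_mem_Ioo_of_mem_PiN hc hn1 hs)
  rw [ha.hasEigenvalue_iff hn1 hw hT.1 (θ := ToeplitzCSL.Theta a n s) fun z => by
    rw [ToeplitzCSL.Theta, ToeplitzCSL.invChiZero, hhat]]
  have e1 : Complex.exp (Complex.I * (n + 1) * s) = Complex.exp (Complex.I * s) ^ (n + 1) := by
    rw [← Complex.exp_nat_mul]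
    congr 1
    push_cast
    ring
  -- Since `b̃_n = b̂_n`, the two functions differ only by `z ↦ z⁻¹`, and the equation becomes the
  -- determinant above.
  have e2 : ∀ z, ToeplitzCSL.hatTheta a n s z = ToeplitzCSL.Theta a n s z⁻¹ := fun z => by
    rw [ToeplitzCSL.hatTheta, htilde, ToeplitzCSL.Theta]
  rw [Complex.exp_neg, Complex.exp_neg, e1, e2, e2, inv_inv, inv_pow]
  refine iff_of_eq (congrArg (· = 0) ?_)
  ring
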